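/- **Theorem 1.4 (exponential decay region).** Let $\lambda_1\in\mathbb C$ with $\operatorname{Im}\lambda_1>0$, let $\alpha,\beta,\gamma\in\mathbb R$, $c_1=\cos(\alpha)e^{\mathrm i\beta}$, $c_2=\sin(\alpha)e^{\mathrm i\gamma}$, $\mathbf c=(1,c_1,c_2)^{\mathrm T}$ and $\sigma_3=\mathrm{diag}(1,-1,-1)$. *Solitons.* Put $\Phi^{[0]}(\lambda;x,t)=e^{-\mathrm i\lambda(x+\lambda t)\sigma_3}$ and, for $j\ge1$, $$\Phi_1^{[j-1]}(x,t)=\lim_{\lambda\to\lambda_1}\Phi^{[j-1]}(\lambda;x,t)\,\mathbf c,\qquad \mathbf P^{[j]}=\frac{\Phi_1^{[j-1]}(\Phi_1^{[j-1]})^\dagger}{(\Phi_1^{[j-1]})^\dagger\Phi_1^{[j-1]}},\qquad \mathbf T^{[j]}(\lambda;x,t)=\mathbb I-\frac{\lambda_1-\lambda_1^*}{\lambda-\lambda_1^*}\mathbf P^{[j]}(x,t),$$ $$\Phi^{[j]}(\lambda;x,t)=\mathbf T^{[j]}(\lambda;x,t)\,\Phi^{[j-1]}(\lambda;x,t)\,\mathbf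 T^{[j]}(\lambda;0,0)^{-1}.$$ Let $\mathbf T_N=\mathbf T^{[N]}\cdots\mathbf T^{[1]}$. The $N$-th order soliton $\mathbf q^{[N]}=(q_1^{[N]},q_2^{[N]})$ of the coupled nonlinear Schrödinger equation $\mathrm i\mathbf q_t+\tfrac12\mathbf q_{xx}+\mathbf q\mathbf q^\dagger\mathbf q=0$ is $q_i^{[N]}=-2(\lambda_1-\lambda_1^*)\sum_{j=1}^N\mathbf P^{[j]}_{1,i+1}$, equivalently $q_i^{[N]}=2\lim_{\lambda\to\infty}\lambda(\mathbf T_N)_{1,i+1}$. In scaled variables write $q_i(X,T)=q_i^{[N]}(NX,NT)$. *Riemann–Hilbert matrix.* Let $D_0$ be a disk centred at $0$ of radius greater than $|\lambda_1|$, $r(\lambda)=\frac{\lambda-\lambda_1}{\lambda-\lambda_1^*}$ (principal powers, cut along the segment between $\lambda_1$ and $\lambda_1^*$), $\theta=\lambda(x+\lambda t)$, and $$\mathbf M^{[N]}(\lambda;x,t)=\begin{cases}r(\lambda)^{-N/3}\,\mathbf T_N(\lambda;x,t),&\lambda\notin D_0,\\ \mathbf T_N(\lambda;x,t)\,e^{-\mathrm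 i\theta\sigma_3}\,\mathbf T_N(\lambda;0,0)^{-1}e^{\mathrm i\theta\sigma_3},&\lambda\in D_0.\end{cases}$$ With $$\mathbf Q_H=\begin{bmatrix}1&0&0\\0&\cos(\alpha)e^{\mathrm i\beta}&-\sin(\alpha)e^{\mathrm i\beta}\\0&\sin(\alpha)e^{\mathrm i\gamma}&\cos(\alpha)e^{\mathrm i\gamma}\end{bmatrix},\quad \widehat{\mathbf Q}_d=\begin{bmatrix}\frac{\sqrt2}2&-\frac{\sqrt2}2&0\\\frac{\sqrt2}2&\frac{\sqrt2}2&0\\0&0&1\end{bmatrix},\quad \mathbf J=\mathrm{diag}\big(r^{2N/3},r^{-N/3},r^{-N/3}\big),$$ let $$\widetilde{\mathbf N}_f(\lambda;X,T)=\begin{cases}\mathbf Q_H^\dagger\mathbf M^{[N]}(\lambda;NX,NT)\mathbf Q_H\,\mathbf J(\lambda)^{-1},&\lambda\notin D_0,\\ \mathbf Q_H^\dagger\mathbf M^{[N]}(\lambda;NX,NT)\mathbf Q_H\,e^{-\mathrm i\lambda N(X+\lambda T)\sigma_3}\,\widehat{\mathbf Q}_d\,e^{\mathrm i\lambda N(X+\lambda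 T)\sigma_3},&\lambda\in D_0.\end{cases}$$ *Exponential decay region.* Let $\varphi(\lambda;X,T)=\mathrm i(\lambda X+\lambda^2T)-\frac12\log\frac{\lambda-\lambda_1}{\lambda-\lambda_1^*}$, so that the critical points of $\varphi$ are the roots of the cubic $(X+2\lambda T)(\lambda-\lambda_1)(\lambda-\lambda_1^*)-\operatorname{Im}\lambda_1$. The point $(X,T)\in\mathbb R^2$ is in the exponential decay region if the discriminant of this cubic is negative and the level set $\operatorname{Re}\varphi(\lambda;X,T)=0$ contains two closed contours, one in the open upper half plane around $\lambda_1$ and one in the open lower half plane around $\lambda_1^*$. Here a closed contour is a simple closed $C^1$ curve with nonvanishing tangent and winding number $1$ around the respective point, carrying no critical point of $\varphi$. *Claim.* If $(X,T)$ is in the exponential decay region, then there is a constant $d>0$, depending only on $\lambda_1,X,T$, such that for all $\alpha,\beta,\gamma$ and $i=1,2$: for every $N$ and every such disk $D_0$, $$q_i(X,T)=2c_i^*\lim_{\lambda\to\infty}\lambda\,\widetilde{\mathbf N}_f(\lambda;X,T)_{12},$$ and $$q_i(X,T)=O(e^{-dN})\qquad\text{as } N\to\infty .$$ -/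

import Mathlib

open Complex Filter Topology Asymptotics Matrix Bornology

noncomputable section

namespace CNLS

/-! ### High order solitons of the focusing coupled NLS equation (iterated Darboux transformation)

Throughout, `z` is the spectral variable and `l₁` the spectral point (with positive imaginary part).
Rows and columns of the `3 × 3` matrices are numbered `0, 1, 2`. -/

/-- `e^{a σ₃}` for `σ₃ = diag(1, -1, -1)`. -/
def expSigma (a : ℂ) : Matrix (Fin 3) (Fin 3) ℂ :=
  Matrix.diagonal ![exp a, exp (-a), exp (-a)]

/-- The components `c₁ = cos α e^{iβ}`, `c₂ = sin α e^{iγ}`: an arbitrary unit vector of `ℂ²`. -/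
def cvec (α β γ : ℝ) : Fin 2 → ℂ :=
  ![(Real.cos α : ℂ) * exp (I * β), (Real.sin α : ℂ) * exp (I * γ)]

/-- The column vector `(1, c₁, c₂)ᵀ`. -/
def seed (c : Fin 2 → ℂ) : Fin 3 → ℂ := ![1, c 0, c 1]

/-- The orthogonal projection `v v† / (v† v)`. -/
def proj (v : Fin 3 → ℂ) : Matrix (Fin 3) (Fin 3) ℂ :=
  (star v ⬝ᵥ v)⁻¹ • vecMulVec v (star v)

/-- The elementary Darboux matrix `𝕀 - (l₁ - l₁*) / (z - l₁*) · v v† / (v† v)`. -/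
def elemDarboux (l₁ : ℂ) (v : Fin 3 → ℂ) (z : ℂ) : Matrix (Fin 3) (Fin 3) ℂ :=
  1 - ((l₁ - star l₁) / (z - star l₁)) • proj v

/-- The vector `lim_{z → l₁} Φ(z) c`, for a matrix function `Φ` (defined off `l₁`). -/
def limVec (l₁ : ℂ) (c : Fin 2 → ℂ) (Φ : ℂ → Matrix (Fin 3) (Fin 3) ℂ) : Fin 3 → ℂ :=
  limUnder (𝓝[≠] l₁) (fun z => Φ z *ᵥ seed c)

/-- The dressed wave functions `Φ^{[j]}(z; x, t)`:
`Φ^{[0]} = e^{-iz(x + zt)σ₃}` and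
`Φ^{[j+1]}(z; x, t) = T^{[j+1]}(z; x, t) Φ^{[j]}(z; x, t) T^{[j+1]}(z; 0, 0)⁻¹`, where `T^{[j+1]}` is
the elementary Darboux matrix of the vector `lim_{z → l₁} Φ^{[j]}(z; x, t) (1, c₁, c₂)ᵀ`. -/
def dressed (l₁ : ℂ) (c : Fin 2 → ℂ) : ℕ → ℝ → ℝ → ℂ → Matrix (Fin 3) (Fin 3) ℂ
  | 0 => fun x t z => expSigma (-(I * z * (x + z * t)))
  | j + 1 => fun x t z =>
      elemDarboux l₁ (limVec l₁ c (dressed l₁ c j x t)) z * dressed l₁ c j x t z *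
        (elemDarboux l₁ (limVec l₁ c (dressed l₁ c j 0 0)) z)⁻¹

/-- The vector `Φ₁^{[j]}(x, t) = lim_{z → l₁} Φ^{[j]}(z; x, t) (1, c₁, c₂)ᵀ`. -/
def dressedVec (l₁ : ℂ) (c : Fin 2 → ℂ) (j : ℕ) (x t : ℝ) : Fin 3 → ℂ :=
  limVec l₁ c (dressed l₁ c j x t)

/-- The Darboux matrix of order `N`, `T_N = T^{[N]} ⋯ T^{[1]}`. -/
def darboux (l₁ : ℂ) (c : Fin 2 → ℂ) : ℕ → ℝ → ℝ → ℂ → Matrix (Fin 3) (Fin 3) ℂ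
  | 0 => fun _ _ _ => 1
  | N + 1 => fun x t z => elemDarboux l₁ (dressedVec l₁ c N x t) z * darboux l₁ c N x t z

/-- The `N`-th order soliton `(q₁, q₂)(x, t)`. It is the `(1, 2)`, `(1, 3)` block of
`[σ₃, T₁]`, where `T_N = 𝕀 + T₁ / z + O(z⁻²)`, that is `T₁ = -(l₁ - l₁*) ∑ P^{[j]}`; equivalently
`q = 2 lim_{z → ∞} z T_N(z; x, t)₁₂`. This is the sign for which `T_N` maps the Lax pair
`Φ_x = i(-zσ₃ + 𝒬)Φ` with zero potential to the Lax pair with potential `q`. -/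
def soliton (l₁ : ℂ) (c : Fin 2 → ℂ) (N : ℕ) (x t : ℝ) (i : Fin 2) : ℂ :=
  -2 * (l₁ - star l₁) * ∑ j ∈ Finset.range N, proj (dressedVec l₁ c j x t) 0 i.succ

/-! ### The sectionally analytic matrices -/

/-- The Blaschke factor `(z - l₁) / (z - l₁*)`. Its principal powers below are cut
only along the segment between `l₁` and `l₁*`. -/
def blaschke (l₁ z : ℂ) : ℂ := (z - l₁) / (z - star l₁)

/-- The matrix `M^{[N]}(z; x, t)` outside (`R ≤ |z|`) and inside (`|z| < R`) the disk `D₀` of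
radius `R` centred at the origin. -/
def matM (l₁ : ℂ) (c : Fin 2 → ℂ) (R : ℝ) (N : ℕ) (x t : ℝ) (z : ℂ) :
    Matrix (Fin 3) (Fin 3) ℂ :=
  open Classical in
  if ‖z‖ < R then
    darboux l₁ c N x t z * expSigma (-(I * z * (x + z * t))) * (darboux l₁ c N 0 0 z)⁻¹ *
      expSigma (I * z * (x + z * t))
  else
    (blaschke l₁ z ^ (-(N : ℂ) / 3)) • darboux l₁ c N x t z

/-- `J_{f,d} = diag(r^{2N/3}, r^{-N/3}, r^{-N/3})` with `r` the Blaschke factor. -/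
def matJ (l₁ : ℂ) (N : ℕ) (z : ℂ) : Matrix (Fin 3) (Fin 3) ℂ :=
  Matrix.diagonal ![blaschke l₁ z ^ (2 * (N : ℂ) / 3), blaschke l₁ z ^ (-(N : ℂ) / 3),
    blaschke l₁ z ^ (-(N : ℂ) / 3)]

/-- The unitary matrix `Q_H`. -/
def matQH (α β γ : ℝ) : Matrix (Fin 3) (Fin 3) ℂ :=
  !![1, 0, 0;
     0, (Real.cos α : ℂ) * exp (I * β), -((Real.sin α : ℂ) * exp (I * β));
     0, (Real.sin α : ℂ) * exp (I * γ), (Real.cos α : ℂ) * exp (I * γ)]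

/-- `Q_d C_d` for `|c| = 1`. -/
def matQd : Matrix (Fin 3) (Fin 3) ℂ :=
  !![1, -1, 0; 1, 1, 0; 0, 0, 1] *
    Matrix.diagonal ![1 / (Real.sqrt 2 : ℂ), 1 / (Real.sqrt 2 : ℂ), 1]

/-- The matrix `Ñ_f(z; X, T)` in the scaled variables `X = x / N`, `T = t / N`. -/
def matN (l₁ : ℂ) (α β γ : ℝ) (R : ℝ) (N : ℕ) (X T : ℝ) (z : ℂ) :
    Matrix (Fin 3) (Fin 3) ℂ :=
  open Classical in
  if ‖z‖ < R then
    (matQH α β γ)ᴴ * matM l₁ (cvec α β γ) R N (N * X) (N * T) z * matQH α β γ *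
      expSigma (-(I * z * N * (X + z * T))) * matQd * expSigma (I * z * N * (X + z * T))
  else
    (matQH α β γ)ᴴ * matM l₁ (cvec α β γ) R N (N * X) (N * T) z * matQH α β γ *
      (matJ l₁ N z)⁻¹

/-! ### The exponential decay region -/

/-- The phase `φ(z; X, T) = i(zX + z²T) - ½ log((z - l₁) / (z - l₁*))`. Only its real part, which
does not depend on the branch of the logarithm, is used. -/
def phase (l₁ : ℂ) (X T : ℝ) (z : ℂ) : ℂ :=
  I * (z * X + z ^ 2 * T) - 1 / 2 * Complex.log (blaschke l₁ z)

/-- The (single-valued) derivative `φ'(z; X, T)`. -/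
def phaseDeriv (l₁ : ℂ) (X T : ℝ) (z : ℂ) : ℂ :=
  I * (X + 2 * z * T) - 1 / 2 * (1 / (z - l₁) - 1 / (z - star l₁))

/-- The cubic `(X + 2zT)(z - l₁)(z - l₁*) - Im l₁`, whose roots are the critical points of `φ`. -/
def criticalCubic (l₁ : ℂ) (X T : ℝ) : Cubic ℝ where
  a := 2 * T
  b := X - 4 * l₁.re * T
  c := 2 * l₁.re ^ 2 * T + 2 * l₁.im ^ 2 * T - 2 * l₁.re * X
  d := X * l₁.im ^ 2 + X * l₁.re ^ 2 - l₁.im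

/-- `g` (with period one) is a closed contour in `H` of the level set `Re φ = 0`: a positively
oriented simple closed `C¹` curve in `H` around the point `p`, on which `Re φ` vanishes, and which
carries no critical point of `φ`, so that no other branch of the level set meets it. -/
structure IsClosedLevelContour (l₁ : ℂ) (X T : ℝ) (H : Set ℂ) (p : ℂ) (g : ℝ → ℂ) : Prop where
  contDiff : ContDiff ℝ 1 g
  periodic : Function.Periodic g 1
  injOn : Set.InjOn g (Set.Ico 0 1)
  deriv_ne : ∀ s, deriv g s ≠ 0
  mem : ∀ s, g s ∈ H
  ne : ∀ s, g s ≠ p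
  re_phase : ∀ s, (phase l₁ X T (g s)).re = 0
  noncritical : ∀ s, phaseDeriv l₁ X T (g s) ≠ 0
  winding : ∫ s in (0 : ℝ)..1, deriv g s / (g s - p) = 2 * Real.pi * I

/-- `(X, T)` is in the exponential decay region: the discriminant of the cubic for the critical
points is negative, and the level set `Re φ = 0` contains two closed contours, one in the upper
half plane around `l₁` and one in the lower half plane around `l₁*`. -/
structure InExpDecayRegion (l₁ : ℂ) (X T : ℝ) : Prop where
  discr_neg : (criticalCubic l₁ X T).discr < 0
  upper : ∃ g, IsClosedLevelContour l₁ X T {z | 0 < z.im} l₁ g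
  lower : ∃ g, IsClosedLevelContour l₁ X T {z | z.im < 0} (star l₁) g

end CNLS

end

/-!
# Exponential decay of the high order soliton

The steepest descent argument can be made elementary here, because all Darboux factors share the
spectral point `l₁`. With `r = blaschke l₁ z`, every factor is `(1 - P) + r P` for an orthogonal
projection `P`, so `T_N = r ^ N + (1 - r) H(r)` for a matrix polynomial `H` of degree less than `N`
in `r` (`bpCofactor`, `darboux_eq`), and the soliton is `2 (l₁ - l₁*) H(1)` at the entries
`(0, 1)`, `(0, 2)` (`soliton_eq`). Let `H_k` be the first row of the `k`-th coefficient of `H`, and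
let `a_k`, `b_k` be the coefficients of the entry `(0, 0)` of `H` and of the combination
`c₁ H₀₁ + c₂ H₀₂`. Three facts give the estimate.

* `T_N` is unitary for real `z`, that is for `|r| = 1`. In terms of `H` this gives the energy
  identity `∑ ‖H_k‖² = ∑ a_k` (`sum_norm_sq_coeffMat_bpCofactor`).
* The dressed wave functions applied to `(1, c₁, c₂)ᵀ` are entire
  (`exists_entire_dressed_mulVec_seed`); hence `∑ a_k r ^ k + e ∑ b_k r ^ k = O(r ^ N)` at `l₁`, where
  `e = exp(2i(zx + z²t))` (`exists_entire_row`). Taking the coefficient of `r ^ (N - 1)` in this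
  relation divided by `1 - r` expresses `∑ a_k` as a combination of the `b_k` whose weights are, up
  to a constant factor, the integrals of `e r ^ (k - N) / (z - l₁*)` over a contour around `l₁`
  (`sum_coeff_eq_neg_sum_integral`).
* At `(x, t) = (N X, N T)` one has `e r ^ (-N) = (e^{2φ}) ^ N`. The closed contour of the level set
  `Re φ = 0` around `l₁` carries no critical point, so it can be pushed to a contour in the upper
  half plane on which `|e^{2φ}| ≤ ρ < 1` (`exists_contour_norm_expPhase_le`). There `|r| ≤ 1`, and
  the weights are `O(ρ ^ N)`.

Thus `∑ ‖H_k‖² ≤ C ρ ^ N ∑ |b_k|`, and the Cauchy–Schwarz inequality turns this quadratic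
inequality into `|q| = O(N ρ ^ N)` (`norm_soliton_le`).

The formula for `q` through `matN` holds because the vectors defining the projections have their last
two components proportional to `(c₁, c₂)` (`eval_one_bpCofactor_row`, `tendsto_mul_matN`).
-/

noncomputable section

namespace CNLS

/-! ### Products of elementary Blaschke–Potapov factors -/

section BlaschkePotapov

open Polynomial

/-- The matrix polynomial `H` of degree less than `N` determined by
`∏ (1 - P j + w P j) = w ^ N + (1 - w) H(w)`, where the product is over `j < N` with the later
factors on the left. -/
def bpCofactor {ι : Type*} [Fintype ι] [DecidableEq ι] (P : ℕ → Matrix ι ι ℂ) :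
    ℕ → Matrix ι ι ℂ[X]
  | 0 => 0
  | N + 1 => (1 - C.mapMatrix (P N)) * bpCofactor P N
      + (X : ℂ[X]) • (C.mapMatrix (P N) * bpCofactor P N)
      + (X ^ N : ℂ[X]) • (1 - C.mapMatrix (P N))

/-- The reflection `w ^ (N - 1) H(1 / w̄)ᴴ` of `H = bpCofactor P N`, for orthogonal projections
`P j`. -/
def bpReflected {ι : Type*} [Fintype ι] [DecidableEq ι] (P : ℕ → Matrix ι ι ℂ) :
    ℕ → Matrix ι ι ℂ[X]
  | 0 => 0
  | N + 1 => bpReflected P N * C.mapMatrix (P N)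
      + (X : ℂ[X]) • (bpReflected P N * (1 - C.mapMatrix (P N)))
      + (1 - C.mapMatrix (P N))

/-- The matrix of the `k`-th coefficients of a matrix polynomial. -/
def coeffMat {ι : Type*} (k : ℕ) (M : Matrix ι ι ℂ[X]) : Matrix ι ι ℂ := M.map (fun p => p.coeff k)

lemma coeffMat_add {ι : Type*} (k : ℕ) (M M' : Matrix ι ι ℂ[X]) :
    coeffMat k (M + M') = coeffMat k M + coeffMat k M' := by
  ext; simp [coeffMat]

lemma coeffMat_sub {ι : Type*} (k : ℕ) (M M' : Matrix ι ι ℂ[X]) :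
    coeffMat k (M - M') = coeffMat k M - coeffMat k M' := by
  ext; simp [coeffMat]

lemma coeffMat_C_mul {ι : Type*} [Fintype ι] (k : ℕ) (A : Matrix ι ι ℂ) (M : Matrix ι ι ℂ[X]) :
    coeffMat k (A.map C * M) = A * coeffMat k M := by
  ext; simp [coeffMat, mul_apply, finsetSum_coeff]

lemma coeffMat_mul_C {ι : Type*} [Fintype ι] (k : ℕ) (A : Matrix ι ι ℂ) (M : Matrix ι ι ℂ[X]) :
    coeffMat k (M * A.map C) = coeffMat k M * A := by
  ext; simp [coeffMat, mul_apply, finsetSum_coeff]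

lemma coeffMat_X_smul_zero {ι : Type*} (M : Matrix ι ι ℂ[X]) :
    coeffMat 0 ((X : ℂ[X]) • M) = 0 := by
  ext; simp [coeffMat]

lemma coeffMat_X_smul_succ {ι : Type*} (k : ℕ) (M : Matrix ι ι ℂ[X]) :
    coeffMat (k + 1) ((X : ℂ[X]) • M) = coeffMat k M := by
  ext; simp [coeffMat]

lemma coeffMat_one_sub_C {ι : Type*} [DecidableEq ι] (k : ℕ) (A : Matrix ι ι ℂ) :
    coeffMat k (1 - A.map C) = if k = 0 then 1 - A else 0 := by
  ext i j
  rcases eq_or_ne i j with rfl | h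
  · by_cases hk : k = 0 <;> simp [coeffMat, coeff_C, coeff_one, hk]
  · by_cases hk : k = 0 <;> simp [coeffMat, coeff_C, hk, h]

lemma coeffMat_X_pow_smul_one_sub_C {ι : Type*} [DecidableEq ι] (k N : ℕ) (A : Matrix ι ι ℂ) :
    coeffMat k ((X ^ N : ℂ[X]) • (1 - A.map C)) = if k = N then 1 - A else 0 := by
  ext i j
  rcases eq_or_ne i j with rfl | h
  · rcases lt_trichotomy k N with hk | rfl | hk
    · simp [coeffMat, coeff_X_pow_mul', hk.ne, hk]
    · simp [coeffMat, coeff_X_pow_mul']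
    · have h1 : k - N ≠ 0 := by omega
      simp [coeffMat, coeff_X_pow_mul', hk.ne', coeff_C, coeff_one, h1]
  · by_cases hk : k = N <;> simp [coeffMat, hk, h]

section Coefficients

variable {ι : Type*} [Fintype ι] [DecidableEq ι] (P : ℕ → Matrix ι ι ℂ)

lemma coeffMat_bpCofactor_zero (N : ℕ) :
    coeffMat 0 (bpCofactor P (N + 1)) =
      (1 - P N) * coeffMat 0 (bpCofactor P N) + if N = 0 then 1 - P N else 0 := by
  simp only [bpCofactor, RingHom.mapMatrix_apply, coeffMat_add, sub_mul, one_mul, coeffMat_sub,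
    coeffMat_C_mul, coeffMat_X_smul_zero, coeffMat_X_pow_smul_one_sub_C, eq_comm (a := N)]
  abel

lemma coeffMat_bpCofactor_succ (N k : ℕ) :
    coeffMat (k + 1) (bpCofactor P (N + 1)) =
      (1 - P N) * coeffMat (k + 1) (bpCofactor P N) + P N * coeffMat k (bpCofactor P N)
        + if k + 1 = N then 1 - P N else 0 := by
  simp only [bpCofactor, RingHom.mapMatrix_apply, coeffMat_add, sub_mul, one_mul, coeffMat_sub,
    coeffMat_C_mul, coeffMat_X_smul_succ, coeffMat_X_pow_smul_one_sub_C]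

lemma coeffMat_bpReflected_zero (N : ℕ) :
    coeffMat 0 (bpReflected P (N + 1)) = coeffMat 0 (bpReflected P N) * P N + (1 - P N) := by
  simp [bpReflected, RingHom.mapMatrix_apply, coeffMat_add, coeffMat_mul_C, coeffMat_X_smul_zero,
    coeffMat_one_sub_C]

lemma coeffMat_bpReflected_succ (N k : ℕ) :
    coeffMat (k + 1) (bpReflected P (N + 1)) =
      coeffMat (k + 1) (bpReflected P N) * P N + coeffMat k (bpReflected P N) * (1 - P N) := by
  simp only [bpReflected, RingHom.mapMatrix_apply, coeffMat_add, coeffMat_one_sub_C, coeffMat_mul_C,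
    coeffMat_X_smul_succ, Nat.succ_ne_zero, if_false, add_zero]
  rw [mul_one_sub, coeffMat_sub, coeffMat_mul_C, mul_one_sub]

lemma coeffMat_bpCofactor_of_le {N k : ℕ} (h : N ≤ k) : coeffMat k (bpCofactor P N) = 0 := by
  induction N generalizing k with
  | zero => ext; simp [coeffMat, bpCofactor]
  | succ N ih =>
    obtain ⟨k, rfl⟩ : ∃ m, k = m + 1 := ⟨k - 1, by omega⟩
    rw [coeffMat_bpCofactor_succ, ih (by omega), ih (by omega), if_neg (by omega)]
    simp

lemma coeffMat_bpReflected_of_le {N k : ℕ} (h : N ≤ k) : coeffMat k (bpReflected P N) = 0 := by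
  induction N generalizing k with
  | zero => ext; simp [coeffMat, bpReflected]
  | succ N ih =>
    obtain ⟨k, rfl⟩ : ∃ m, k = m + 1 := ⟨k - 1, by omega⟩
    rw [coeffMat_bpReflected_succ, ih (by omega), ih (by omega)]
    simp

lemma coeffMat_bpReflected (hP : ∀ j, (P j)ᴴ = P j) {N a b : ℕ} (h : a + b + 1 = N) :
    coeffMat a (bpReflected P N) = (coeffMat b (bpCofactor P N))ᴴ := by
  induction N generalizing a b with
  | zero => omega
  | succ N ih =>
    rcases a with _ | a <;> rcases b with _ | b
    · obtain rfl : N = 0 := by omega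
      have h0 : coeffMat 0 (bpReflected P 0) = 0 := coeffMat_bpReflected_of_le P le_rfl
      have h1 : coeffMat 0 (bpCofactor P 0) = 0 := coeffMat_bpCofactor_of_le P le_rfl
      rw [coeffMat_bpReflected_zero, coeffMat_bpCofactor_zero, h0, h1]
      simp [hP]
    · rw [coeffMat_bpReflected_zero, coeffMat_bpCofactor_succ, if_pos (by omega),
        coeffMat_bpCofactor_of_le P (k := b + 1) (by omega), ih (a := 0) (b := b) (by omega)]
      simp [hP]
    · rw [coeffMat_bpReflected_succ, coeffMat_bpCofactor_zero, if_neg (by omega),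
        coeffMat_bpReflected_of_le P (k := a + 1) (by omega), ih (a := a) (b := 0) (by omega)]
      simp [hP]
    · rw [coeffMat_bpReflected_succ, coeffMat_bpCofactor_succ, if_neg (by omega),
        ih (a := a + 1) (b := b) (by omega), ih (a := a) (b := b + 1) (by omega)]
      simp [hP, add_comm]

end Coefficients

/-- The inductive step of `smul_bpCofactor_mul_bpReflected`, for `h` the cofactor, `k` its reflection,
`p` the new projection, and scalars `x = w`, `y = w ^ N`. -/
lemma reflection_step {K A : Type*} [CommRing K] [Ring A] [Algebra K A] (x y : K) (p h k : A)
    (hp : p * p = p) (hk : (1 - x) • (h * k) = h - y • k) :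
    (1 - x) • (((1 - p) * h + x • (p * h) + y • (1 - p)) *
        (k * p + x • (k * (1 - p)) + (1 - p))) =
      ((1 - p) * h + x • (p * h) + y • (1 - p)) -
        (y * x) • (k * p + x • (k * (1 - p)) + (1 - p)) := by
  have key : (1 - p + x • p) * ((1 - x) • (h * k)) * (p + x • (1 - p)) =
      (1 - p + x • p) * (h - y • k) * (p + x • (1 - p)) := by rw [hk]
  have e : ∀ u v w : A, u = v → w - u = 0 → w = v := fun u v w h1 h2 => by
    rw [← h1]; exact sub_eq_zero.1 h2
  rw [← sub_eq_zero] at key ⊢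
  refine e _ _ _ key ?_
  simp only [mul_add, add_mul, mul_sub, sub_mul, smul_mul_assoc, mul_smul_comm, one_mul, mul_one,
    mul_assoc, hp, smul_add, smul_sub, smul_smul]
  module

/-- The unitarity of the product `w ^ N + (1 - w) H(w)` on the unit circle, divided by `1 - w`. -/
lemma smul_bpCofactor_mul_bpReflected {ι : Type*} [Fintype ι] [DecidableEq ι]
    (P : ℕ → Matrix ι ι ℂ) (hP : ∀ j, P j * P j = P j) (N : ℕ) :
    (1 - X : ℂ[X]) • (bpCofactor P N * bpReflected P N) =
      bpCofactor P N - (X ^ N : ℂ[X]) • bpReflected P N := by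
  induction N with
  | zero => simp [bpCofactor, bpReflected]
  | succ N ih =>
    rw [pow_succ]
    exact reflection_step X (X ^ N) (C.mapMatrix (P N)) _ _ (by rw [← map_mul, hP]) ih

lemma sum_coeff_one_sub_X_mul (Q : ℂ[X]) (N : ℕ) :
    ∑ k ∈ Finset.range (N + 1), ((1 - X) * Q).coeff k = Q.coeff N := by
  induction N with
  | zero => simp
  | succ N ih =>
    rw [Finset.sum_range_succ, ih, sub_mul, one_mul, coeff_sub, coeff_X_mul]
    ring

/-- Energy identity: the boundary values of a product of Blaschke–Potapov factors are unitary, and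
in terms of `H = bpCofactor P N` this says that the squared norm of a row of `H` on the unit circle
equals the diagonal entry of `H(1)`. -/
lemma sum_norm_sq_coeffMat_bpCofactor {ι : Type*} [Fintype ι] [DecidableEq ι]
    (P : ℕ → Matrix ι ι ℂ) (hP : ∀ j, P j * P j = P j) (hP' : ∀ j, (P j)ᴴ = P j) (N : ℕ) (i : ι) :
    ((∑ k ∈ Finset.range N, ∑ j, ‖coeffMat k (bpCofactor P N) i j‖ ^ 2 : ℝ) : ℂ) =
      ∑ k ∈ Finset.range N, coeffMat k (bpCofactor P N) i i := by
  rcases N with _ | N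
  · simp
  have h := congr_fun (congr_fun (smul_bpCofactor_mul_bpReflected P hP (N + 1)) i) i
  have h2 := sum_coeff_one_sub_X_mul ((bpCofactor P (N + 1) * bpReflected P (N + 1)) i i) N
  rw [Matrix.smul_apply, smul_eq_mul] at h
  rw [h] at h2
  have h3 : ∀ k ∈ Finset.range (N + 1),
      ((bpCofactor P (N + 1) - (X ^ (N + 1) : ℂ[X]) • bpReflected P (N + 1)) i i).coeff k =
        coeffMat k (bpCofactor P (N + 1)) i i := by
    intro k hk
    have : ¬ N + 1 ≤ k := by simpa using hk
    simp [coeffMat, coeff_X_pow_mul', this]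
  rw [Finset.sum_congr rfl h3] at h2
  rw [h2, mul_apply, finsetSum_coeff]
  push_cast
  rw [Finset.sum_comm]
  refine Finset.sum_congr rfl fun j _ => ?_
  rw [coeff_mul, Finset.Nat.sum_antidiagonal_eq_sum_range_succ_mk]
  refine Finset.sum_congr rfl fun k hk => ?_
  have hk' : k ≤ N := by simpa [Nat.lt_succ_iff] using hk
  have := congr_fun (congr_fun (coeffMat_bpReflected P hP' (N := N + 1) (a := N - k) (b := k)
    (by omega)) j) i
  simp only [coeffMat, map_apply, conjTranspose_apply] at this
  rw [this]
  simp [coeffMat, Complex.mul_conj, Complex.normSq_eq_norm_sq]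

lemma eval_bpCofactor_succ {ι : Type*} [Fintype ι] [DecidableEq ι] (P : ℕ → Matrix ι ι ℂ)
    (N : ℕ) (w : ℂ) :
    (evalRingHom w).mapMatrix (bpCofactor P (N + 1)) =
      (1 - P N) * (evalRingHom w).mapMatrix (bpCofactor P N)
        + w • (P N * (evalRingHom w).mapMatrix (bpCofactor P N)) + w ^ N • (1 - P N) := by
  have hC : (evalRingHom w).mapMatrix (C.mapMatrix (P N)) = P N := by ext; simp
  have hs : ∀ (q : ℂ[X]) (M : Matrix ι ι ℂ[X]), (evalRingHom w).mapMatrix (q • M) =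
      q.eval w • (evalRingHom w).mapMatrix M := fun q M => by ext; simp
  simp only [bpCofactor, map_add, map_mul, hs, map_sub, map_one, hC, eval_X, eval_pow]

lemma eval_bpCofactor_eq_sum {ι : Type*} [Fintype ι] [DecidableEq ι] (P : ℕ → Matrix ι ι ℂ)
    (N : ℕ) (w : ℂ) (i j : ι) :
    (evalRingHom w).mapMatrix (bpCofactor P N) i j =
      ∑ k ∈ Finset.range N, coeffMat k (bpCofactor P N) i j * w ^ k := by
  have h : (bpCofactor P N i j).degree < N := by
    rw [degree_lt_iff_coeff_zero]
    intro m hm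
    exact congr_fun (congr_fun (coeffMat_bpCofactor_of_le P hm) i) j
  simp only [RingHom.mapMatrix_apply, map_apply, coe_evalRingHom]
  rw [eval_eq_sum_degreeLTEquiv (mem_degreeLT.2 h), ← Fin.sum_univ_eq_sum_range
    (fun k => coeffMat k (bpCofactor P N) i j * w ^ k)]
  rfl

lemma eval_one_bpCofactor {ι : Type*} [Fintype ι] [DecidableEq ι] (P : ℕ → Matrix ι ι ℂ) (N : ℕ) :
    (evalRingHom 1).mapMatrix (bpCofactor P N) = ∑ j ∈ Finset.range N, (1 - P j) := by
  induction N with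
  | zero => simp [bpCofactor]
  | succ N ih =>
    rw [eval_bpCofactor_succ, Finset.sum_range_succ, ← ih, sub_mul]
    simp

end BlaschkePotapov

/-! ### The contour of steepest descent -/

/-- The multiplier `e^{2φ(z)} = e^{2i(zX + z²T)} (z - l₁*) / (z - l₁)`, which does not depend on
the branch of the logarithm in `phase`. -/
def expPhase (l₁ : ℂ) (X T : ℝ) (z : ℂ) : ℂ :=
  exp (2 * I * (z * X + z ^ 2 * T)) * ((z - star l₁) / (z - l₁))

lemma ne_star_of_im_pos {l₁ z : ℂ} (hl₁ : 0 < l₁.im) (hz : 0 < z.im) : z ≠ star l₁ := by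
  rintro rfl
  simp at hz
  linarith

lemma norm_expPhase {l₁ z : ℂ} (X T : ℝ) (h1 : z ≠ l₁) (h2 : z ≠ star l₁) :
    ‖expPhase l₁ X T z‖ = Real.exp (2 * (phase l₁ X T z).re) := by
  have hb : 0 < ‖blaschke l₁ z‖ := by
    rw [norm_pos_iff]
    exact div_ne_zero (sub_ne_zero.2 h1) (sub_ne_zero.2 h2)
  have e1 : (z - star l₁) / (z - l₁) = (blaschke l₁ z)⁻¹ := by rw [blaschke, inv_div]
  have e2 : (phase l₁ X T z).re = (I * (z * X + z ^ 2 * T)).re -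
      1 / 2 * Real.log ‖blaschke l₁ z‖ := by
    have : (1 / 2 : ℂ) = ((1 / 2 : ℝ) : ℂ) := by norm_num
    rw [phase, sub_re, this, re_ofReal_mul, Complex.log_re]
  rw [expPhase, e1, norm_mul, norm_inv, norm_exp, e2, mul_sub, ← mul_assoc,
    show (2 : ℝ) * (1 / 2) = 1 by norm_num, one_mul, Real.exp_sub, Real.exp_log hb, ← div_eq_mul_inv,
    mul_assoc, show (2 : ℂ) = ((2 : ℝ) : ℂ) by norm_num, re_ofReal_mul]

lemma hasDerivAt_expPhase {l₁ z : ℂ} (X T : ℝ) (h1 : z ≠ l₁) (h2 : z ≠ star l₁) :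
    HasDerivAt (expPhase l₁ X T) (2 * phaseDeriv l₁ X T z * expPhase l₁ X T z) z := by
  have h1' := sub_ne_zero.2 h1
  have h2' := sub_ne_zero.2 h2
  have a : HasDerivAt (fun z : ℂ => 2 * I * (z * X + z ^ 2 * T)) (2 * I * (X + 2 * z * T)) z := by
    have := (((hasDerivAt_id z).mul_const (X : ℂ)).add
      (((hasDerivAt_id z).pow 2).mul_const (T : ℂ))).const_mul (2 * I)
    refine HasDerivAt.congr_deriv this ?_
    simp
  have b : HasDerivAt (fun z => (z - star l₁) / (z - l₁))
      ((1 * (z - l₁) - (z - star l₁) * 1) / (z - l₁) ^ 2) z :=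
    ((hasDerivAt_id z).sub_const (star l₁)).div ((hasDerivAt_id z).sub_const l₁) h1'
  refine HasDerivAt.congr_deriv (a.cexp.mul b) ?_
  simp only [expPhase, phaseDeriv]
  field_simp
  ring

/-- The winding number does not change under a small perturbation: `log ((f - p) / (g - p))` is a
single-valued primitive of the difference of the integrands. -/
lemma integral_deriv_div_sub_eq {f g : ℝ → ℂ} {p : ℂ} (hf : ContDiff ℝ 1 f) (hg : ContDiff ℝ 1 g)
    (hf1 : f 1 = f 0) (hg1 : g 1 = g 0) (hgp : ∀ s ∈ Set.Icc (0 : ℝ) 1, g s ≠ p)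
    (hfg : ∀ s ∈ Set.Icc (0 : ℝ) 1, ‖(f s - p) / (g s - p) - 1‖ < 1) :
    ∫ s in (0 : ℝ)..1, deriv f s / (f s - p) = ∫ s in (0 : ℝ)..1, deriv g s / (g s - p) := by
  have hu : Set.uIcc (0 : ℝ) 1 = Set.Icc 0 1 := Set.uIcc_of_le zero_le_one
  have hfp : ∀ s ∈ Set.Icc (0 : ℝ) 1, f s ≠ p := by
    intro s hs h
    have := hfg s hs
    simp [h] at this
  have cf : ContinuousOn (fun s => deriv f s / (f s - p)) (Set.Icc 0 1) :=
    (hf.continuous_deriv le_rfl).continuousOn.div (hf.continuous.sub continuous_const).continuousOn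
      fun s hs => sub_ne_zero.2 (hfp s hs)
  have cg : ContinuousOn (fun s => deriv g s / (g s - p)) (Set.Icc 0 1) :=
    (hg.continuous_deriv le_rfl).continuousOn.div (hg.continuous.sub continuous_const).continuousOn
      fun s hs => sub_ne_zero.2 (hgp s hs)
  rw [← sub_eq_zero, ← intervalIntegral.integral_sub (cf.mono hu.le).intervalIntegrable
    (cg.mono hu.le).intervalIntegrable]
  rw [intervalIntegral.integral_eq_sub_of_hasDerivAt
    (f := fun s => Complex.log ((f s - p) / (g s - p)))]
  · simp [hf1, hg1]
  · intro s hs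
    rw [hu] at hs
    have h1 := sub_ne_zero.2 (hfp s hs)
    have h2 := sub_ne_zero.2 (hgp s hs)
    have df := (((hf.differentiable one_ne_zero) s).hasDerivAt.sub_const p)
    have dg := (((hg.differentiable one_ne_zero) s).hasDerivAt.sub_const p)
    have hs' : (f s - p) / (g s - p) ∈ slitPlane := by
      have := mem_slitPlane_of_norm_lt_one (hfg s hs)
      simpa using this
    refine HasDerivAt.congr_deriv ((df.div dg h2).clog_real hs') ?_
    simp only [Pi.div_apply]
    field_simp
  · exact ((cf.sub cg).mono hu.le).intervalIntegrable

/-- A closed contour of the level set `Re φ = 0` in the upper half plane without critical points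
can be pushed in the direction of `-∇ Re φ` to a contour around `l₁` on which
`|e^{2φ}| ≤ ρ < 1`. -/
lemma exists_contour_norm_expPhase_le {l₁ : ℂ} (hl₁ : 0 < l₁.im) {X T : ℝ} {g : ℝ → ℂ}
    (hg : IsClosedLevelContour l₁ X T {z | 0 < z.im} l₁ g) :
    ∃ (f : ℝ → ℂ) (ρ : ℝ), ContDiff ℝ 1 f ∧ f 1 = f 0 ∧
      (∀ s ∈ Set.Icc (0 : ℝ) 1, 0 < (f s).im ∧ f s ≠ l₁) ∧
      (∫ s in (0 : ℝ)..1, deriv f s / (f s - l₁) = 2 * Real.pi * I) ∧ ρ < 1 ∧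
      ∀ s ∈ Set.Icc (0 : ℝ) 1, ‖expPhase l₁ X T (f s)‖ ≤ ρ := by
  have hgc := hg.contDiff
  have hne1 : ∀ s, g s - l₁ ≠ 0 := fun s => sub_ne_zero.2 (hg.ne s)
  have hne2 : ∀ s, g s - star l₁ ≠ 0 := fun s => sub_ne_zero.2 (ne_star_of_im_pos hl₁ (hg.mem s))
  set D : ℝ → ℂ := fun s => -(phaseDeriv l₁ X T (g s))⁻¹ with hD
  have hDc : ContDiff ℝ 1 D := by
    refine (ContDiff.inv ?_ hg.noncritical).neg
    unfold phaseDeriv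
    simp only [one_div]
    refine ContDiff.sub (by fun_prop) (contDiff_const.mul (ContDiff.sub ?_ ?_))
    · exact (hgc.sub contDiff_const).inv hne1
    · exact (hgc.sub contDiff_const).inv hne2
  have hg1 : g 1 = g 0 := by simpa using hg.periodic 0
  have hD1 : D 1 = D 0 := by simp [hD, hg1]
  -- the three open conditions under which the contour may be moved by `ε D`
  have hev : ∀ᶠ ε : ℝ in 𝓝 0, ∀ s ∈ Set.Icc (0 : ℝ) 1, 0 < (g s + ε * D s).im ∧
      ‖(g s + ε * D s - l₁) / (g s - l₁) - 1‖ < 1 ∧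
      (phaseDeriv l₁ X T (g s + ε * D s) * D s).re < 0 := by
    refine isCompact_Icc.eventually_forall_of_forall_eventually fun s _ => ?_
    have hgp : Continuous fun q : ℝ × ℝ => g q.2 := hgc.continuous.comp continuous_snd
    have hDp : Continuous fun q : ℝ × ℝ => D q.2 := hDc.continuous.comp continuous_snd
    have hc : Continuous fun q : ℝ × ℝ => g q.2 + q.1 * D q.2 :=
      hgp.add ((continuous_ofReal.comp continuous_fst).mul hDp)
    have h0 : g s + ((0 : ℝ) : ℂ) * D s = g s := by simp
    refine Filter.Eventually.and ?_ (Filter.Eventually.and ?_ ?_)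
    · refine continuousAt_const.eventually_lt (Complex.continuous_im.comp hc).continuousAt ?_
      simpa using hg.mem s
    · have : Continuous fun q : ℝ × ℝ => ‖(g q.2 + q.1 * D q.2 - l₁) / (g q.2 - l₁) - 1‖ :=
        (((hc.sub continuous_const).div (hgp.sub continuous_const) fun q => hne1 q.2).sub
          continuous_const).norm
      refine this.continuousAt.eventually_lt continuousAt_const ?_
      simp only [h0, div_self (hne1 s)]
      simp
    · have hp : ContinuousAt (phaseDeriv l₁ X T) (g s) := by
        unfold phaseDeriv
        refine ContinuousAt.sub (by fun_prop) (continuousAt_const.mul (ContinuousAt.sub ?_ ?_))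
        · exact continuousAt_const.div (by fun_prop) (hne1 s)
        · exact continuousAt_const.div (by fun_prop) (hne2 s)
      have hp' : ContinuousAt (fun q : ℝ × ℝ => phaseDeriv l₁ X T (g q.2 + q.1 * D q.2)) (0, s) :=
        ContinuousAt.comp (g := phaseDeriv l₁ X T) (by simpa using hp) hc.continuousAt
      have : ContinuousAt (fun q : ℝ × ℝ =>
          (phaseDeriv l₁ X T (g q.2 + q.1 * D q.2) * D q.2).re) (0, s) :=
        Complex.continuous_re.continuousAt.comp (hp'.mul hDp.continuousAt)
      refine this.eventually_lt continuousAt_const ?_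
      have : phaseDeriv l₁ X T (g s) * D s = -1 := by
        simp only [hD, mul_neg, mul_inv_cancel₀ (hg.noncritical s)]
      simp only [h0, this]
      simp
  obtain ⟨δ, hδ, hball⟩ := Metric.eventually_nhds_iff_ball.1 hev
  set ε := δ / 2 with hε
  have hε0 : 0 < ε := by positivity
  have hin : ∀ x ∈ Set.Icc (0 : ℝ) ε, x ∈ Metric.ball (0 : ℝ) δ := by
    intro x hx
    rw [Metric.mem_ball, Real.dist_eq, sub_zero, abs_of_nonneg hx.1]
    linarith [hx.2]
  have hneq : ∀ x ∈ Set.Icc (0 : ℝ) ε, ∀ s ∈ Set.Icc (0 : ℝ) 1, g s + x * D s ≠ l₁ := by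
    intro x hx s hs h
    have := (hball x (hin x hx) s hs).2.1
    simp [h] at this
  set f : ℝ → ℂ := fun s => g s + ε * D s with hf
  have hfc : ContDiff ℝ 1 f := hgc.add (contDiff_const.mul hDc)
  have hεm : ε ∈ Set.Icc (0 : ℝ) ε := ⟨hε0.le, le_rfl⟩
  have him : ∀ s ∈ Set.Icc (0 : ℝ) 1, 0 < (f s).im := fun s hs => (hball ε (hin ε hεm) s hs).1
  have hfl : ∀ s ∈ Set.Icc (0 : ℝ) 1, f s ≠ l₁ := fun s hs => hneq ε hεm s hs
  have hlt : ∀ s ∈ Set.Icc (0 : ℝ) 1, ‖expPhase l₁ X T (f s)‖ < 1 := by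
    intro s hs
    have hder : ∀ x ∈ Set.Icc (0 : ℝ) ε, HasDerivAt
        (fun x : ℝ => ‖expPhase l₁ X T (g s + x * D s)‖ ^ 2)
        (2 * inner ℝ (expPhase l₁ X T (g s + x * D s))
          (2 * phaseDeriv l₁ X T (g s + x * D s) * expPhase l₁ X T (g s + x * D s) * D s)) x := by
      intro x hx
      have hu := hasDerivAt_expPhase X T (hneq x hx s hs)
        (ne_star_of_im_pos hl₁ (hball x (hin x hx) s hs).1)
      have hl : HasDerivAt (fun x : ℝ => g s + (x : ℂ) * D s) (D s) x := by
        simpa using ((hasDerivAt_id x).ofReal_comp.mul_const (D s)).const_add (g s)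
      exact (hu.comp x hl).norm_sq
    have hanti : StrictAntiOn (fun x : ℝ => ‖expPhase l₁ X T (g s + x * D s)‖ ^ 2)
        (Set.Icc 0 ε) := by
      refine strictAntiOn_of_deriv_neg (convex_Icc 0 ε)
        (fun x hx => (hder x hx).continuousAt.continuousWithinAt) fun x hx => ?_
      have hx' := interior_subset hx
      rw [(hder x hx').deriv]
      have hpos : 0 < ‖expPhase l₁ X T (g s + x * D s)‖ := by
        rw [norm_expPhase X T (hneq x hx' s hs)
          (ne_star_of_im_pos hl₁ (hball x (hin x hx') s hs).1)]
        exact Real.exp_pos _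
      have hneg := (hball x (hin x hx') s hs).2.2
      set u := expPhase l₁ X T (g s + x * D s)
      set w := phaseDeriv l₁ X T (g s + x * D s) * D s with hw
      have e : 2 * phaseDeriv l₁ X T (g s + x * D s) * u * D s = (2 * w) * u := by rw [hw]; ring
      have : inner ℝ u ((2 * w) * u) = 2 * w.re * ‖u‖ ^ 2 := by
        rw [Complex.inner, ← normSq_eq_norm_sq, mul_assoc, Complex.mul_conj, mul_comm,
          re_ofReal_mul]
        simp [mul_comm]
      rw [e, this]
      nlinarith [mul_pos_of_neg_of_neg hneg (neg_lt_zero.2 (pow_pos hpos 2))]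
    have := hanti ⟨le_rfl, hε0.le⟩ hεm hε0
    have h0 : ‖expPhase l₁ X T (g s)‖ = 1 := by
      rw [norm_expPhase X T (hg.ne s) (ne_star_of_im_pos hl₁ (hg.mem s)), hg.re_phase]
      simp
    simp only [ofReal_zero, zero_mul, add_zero, h0] at this
    rw [one_pow] at this
    exact (sq_lt_one_iff₀ (norm_nonneg _)).1 this
  have hcont : ContinuousOn (fun s => ‖expPhase l₁ X T (f s)‖) (Set.Icc 0 1) := by
    intro s hs
    have := (hasDerivAt_expPhase X T (hfl s hs) (ne_star_of_im_pos hl₁ (him s hs))).continuousAt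
    exact (ContinuousAt.comp (f := f) this
      hfc.continuous.continuousAt).norm.continuousWithinAt
  obtain ⟨s₀, hs₀, hmax⟩ := isCompact_Icc.exists_isMaxOn (Set.nonempty_Icc.2 zero_le_one) hcont
  have hf1 : f 1 = f 0 := by simp [hf, hg1, hD1]
  refine ⟨f, _, hfc, hf1, fun s hs => ⟨him s hs, hfl s hs⟩, ?_, hlt s₀ hs₀,
    fun s hs => hmax hs⟩
  rw [← hg.winding]
  exact integral_deriv_div_sub_eq hfc hgc hf1 hg1 (fun s _ => hg.ne s)
    fun s hs => (hball ε (hin ε hεm) s hs).2.1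

/-! ### Contour integrals against powers of the Blaschke factor -/

lemma blaschke_ne_zero {l₁ z : ℂ} (h1 : z ≠ l₁) (h2 : z ≠ star l₁) : blaschke l₁ z ≠ 0 :=
  div_ne_zero (sub_ne_zero.2 h1) (sub_ne_zero.2 h2)

lemma norm_blaschke_le_one {l₁ z : ℂ} (hl₁ : 0 < l₁.im) (hz : 0 < z.im) :
    ‖blaschke l₁ z‖ ≤ 1 := by
  have h2 := ne_star_of_im_pos hl₁ hz
  rw [blaschke, norm_div, div_le_one (norm_pos_iff.2 (sub_ne_zero.2 h2)),
    ← sq_le_sq₀ (norm_nonneg _) (norm_nonneg _), ← normSq_eq_norm_sq, ← normSq_eq_norm_sq,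
    normSq_apply, normSq_apply]
  simp only [sub_re, sub_im, Complex.star_def, conj_re, conj_im]
  nlinarith [mul_pos hl₁ hz]

lemma sub_star_ne_zero {l₁ : ℂ} (hl₁ : 0 < l₁.im) : l₁ - star l₁ ≠ 0 :=
  sub_ne_zero.2 (ne_star_of_im_pos hl₁ hl₁)

lemma one_sub_blaschke {l₁ z : ℂ} (h2 : z ≠ star l₁) :
    1 - blaschke l₁ z = (l₁ - star l₁) / (z - star l₁) := by
  have := sub_ne_zero.2 h2
  rw [blaschke]
  field_simp
  ring

lemma hasDerivAt_blaschke {l₁ z : ℂ} (h2 : z ≠ star l₁) :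
    HasDerivAt (blaschke l₁) ((l₁ - star l₁) / (z - star l₁) ^ 2) z := by
  have b : HasDerivAt (fun z => (z - l₁) / (z - star l₁))
      ((1 * (z - star l₁) - (z - l₁) * 1) / (z - star l₁) ^ 2) z :=
    ((hasDerivAt_id z).sub_const l₁).div ((hasDerivAt_id z).sub_const (star l₁)) (sub_ne_zero.2 h2)
  refine HasDerivAt.congr_deriv b ?_
  ring

lemma integral_comp_mul_deriv_eq_zero {f : ℝ → ℂ} (hf : ContDiff ℝ 1 f) (hf1 : f 1 = f 0)
    {F G : ℂ → ℂ} (hG : ∀ s ∈ Set.Icc (0 : ℝ) 1, HasDerivAt G (F (f s)) (f s))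
    (hF : ContinuousOn (fun s => F (f s)) (Set.Icc 0 1)) :
    ∫ s in (0 : ℝ)..1, F (f s) * deriv f s = 0 := by
  have hu : Set.uIcc (0 : ℝ) 1 = Set.Icc 0 1 := Set.uIcc_of_le zero_le_one
  rw [intervalIntegral.integral_eq_sub_of_hasDerivAt (f := fun s => G (f s))]
  · simp [hf1]
  · intro s hs
    exact (hG s (hu ▸ hs)).comp s (hf.differentiable one_ne_zero s).hasDerivAt
  · exact ((hF.mul (hf.continuous_deriv le_rfl).continuousOn).mono hu.le).intervalIntegrable

lemma integral_entire_mul_deriv_eq_zero {f : ℝ → ℂ} (hf : ContDiff ℝ 1 f) (hf1 : f 1 = f 0)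
    {F : ℂ → ℂ} (hF : Differentiable ℂ F) :
    ∫ s in (0 : ℝ)..1, F (f s) * deriv f s = 0 := by
  obtain ⟨G, hG⟩ := hF.isExactOn_univ
  exact integral_comp_mul_deriv_eq_zero hf hf1 (fun s _ => hG _ (Set.mem_univ _))
    (hF.continuous.comp hf.continuous).continuousOn

section Contour

variable {l₁ : ℂ} {f : ℝ → ℂ}

lemma continuousOn_blaschke_comp (hl₁ : 0 < l₁.im) (hf : ContDiff ℝ 1 f)
    (him : ∀ s ∈ Set.Icc (0 : ℝ) 1, 0 < (f s).im) :
    ContinuousOn (fun s => blaschke l₁ (f s)) (Set.Icc 0 1) := fun s hs =>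
  (ContinuousAt.comp (f := f) (hasDerivAt_blaschke (ne_star_of_im_pos hl₁ (him s hs))).continuousAt
    hf.continuous.continuousAt).continuousWithinAt

lemma continuousOn_kernel (hl₁ : 0 < l₁.im) (hf : ContDiff ℝ 1 f)
    (him : ∀ s ∈ Set.Icc (0 : ℝ) 1, 0 < (f s).im ∧ f s ≠ l₁) (m : ℕ) :
    ContinuousOn (fun s => (blaschke l₁ (f s) ^ m)⁻¹ / (f s - star l₁)) (Set.Icc 0 1) := by
  refine ContinuousOn.div (ContinuousOn.inv₀ ((continuousOn_blaschke_comp hl₁ hf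
    fun s hs => (him s hs).1).pow m) fun s hs => pow_ne_zero _ (blaschke_ne_zero (him s hs).2
      (ne_star_of_im_pos hl₁ (him s hs).1))) (hf.continuous.sub continuous_const).continuousOn
      fun s hs => sub_ne_zero.2 (ne_star_of_im_pos hl₁ (him s hs).1)

/-- The kernel `r ^ (-(m + 1)) / (z - l₁*)` times `dz` is `dr / (r ^ (m + 1) (1 - r))`, with
residue `1` at `r = 0`. -/
lemma integral_kernel (hl₁ : 0 < l₁.im) (hf : ContDiff ℝ 1 f) (hf1 : f 1 = f 0)
    (him : ∀ s ∈ Set.Icc (0 : ℝ) 1, 0 < (f s).im ∧ f s ≠ l₁)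
    (hw : ∫ s in (0 : ℝ)..1, deriv f s / (f s - l₁) = 2 * Real.pi * I) (m : ℕ) :
    ∫ s in (0 : ℝ)..1, (blaschke l₁ (f s) ^ (m + 1))⁻¹ / (f s - star l₁) * deriv f s =
      2 * Real.pi * I := by
  have hu : Set.uIcc (0 : ℝ) 1 = Set.Icc 0 1 := Set.uIcc_of_le zero_le_one
  induction m with
  | zero =>
    rw [← hw]
    refine intervalIntegral.integral_congr fun s hs => ?_
    rw [hu] at hs
    have h1 := sub_ne_zero.2 (him s hs).2
    have h2 := sub_ne_zero.2 (ne_star_of_im_pos hl₁ (him s hs).1)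
    simp only [blaschke, zero_add, pow_one]
    field_simp
  | succ m ih =>
    rw [← ih, ← sub_eq_zero, ← intervalIntegral.integral_sub]
    · -- the difference of consecutive kernels has the primitive `-r ^ (-(m + 1)) / (m + 1)`
      have key := integral_comp_mul_deriv_eq_zero hf hf1
        (F := fun z => (blaschke l₁ z ^ (m + 1 + 1))⁻¹ / (z - star l₁) -
          (blaschke l₁ z ^ (m + 1))⁻¹ / (z - star l₁))
        (G := fun z => -((m : ℂ) + 1)⁻¹ * (blaschke l₁ z ^ (m + 1))⁻¹) ?_ ?_
      · rw [← key]
        refine intervalIntegral.integral_congr fun s _ => ?_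
        ring
      · intro s hs
        have h2 := ne_star_of_im_pos hl₁ (him s hs).1
        have h3 := blaschke_ne_zero (him s hs).2 h2
        have h2' := sub_ne_zero.2 h2
        have hm : (m : ℂ) + 1 ≠ 0 := Nat.cast_add_one_ne_zero m
        refine HasDerivAt.congr_deriv ((((hasDerivAt_blaschke h2).pow (m + 1)).inv
          (pow_ne_zero _ h3)).const_mul _) ?_
        have e : (l₁ - star l₁) / (f s - star l₁) ^ 2 =
            (1 - blaschke l₁ (f s)) / (f s - star l₁) := by
          rw [one_sub_blaschke h2, div_div, sq]
        simp only [e, Pi.pow_apply, Nat.add_sub_cancel]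
        push_cast
        field_simp
        ring
      · exact (continuousOn_kernel hl₁ hf him _).sub (continuousOn_kernel hl₁ hf him _)
    · exact (((continuousOn_kernel hl₁ hf him _).mul
        (hf.continuous_deriv le_rfl).continuousOn).mono hu.le).intervalIntegrable
    · exact (((continuousOn_kernel hl₁ hf him _).mul
        (hf.continuous_deriv le_rfl).continuousOn).mono hu.le).intervalIntegrable

/-- If the polynomials with coefficients `h` and `g` satisfy `h(r) + e g(r) = O(r ^ N)` at `l₁`,
then `h(1)`, as the coefficient of `r ^ (N - 1)` in `h(r) / (1 - r)`, is a contour integral of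
`e g(r)`. -/
lemma sum_coeff_eq_neg_sum_integral (hl₁ : 0 < l₁.im) (hf : ContDiff ℝ 1 f) (hf1 : f 1 = f 0)
    (him : ∀ s ∈ Set.Icc (0 : ℝ) 1, 0 < (f s).im ∧ f s ≠ l₁)
    (hw : ∫ s in (0 : ℝ)..1, deriv f s / (f s - l₁) = 2 * Real.pi * I)
    {N : ℕ} {h g : ℕ → ℂ} {e A : ℂ → ℂ} (he : Continuous e) (hA : Differentiable ℂ A)
    (hhg : ∀ z, z ≠ l₁ → z ≠ star l₁ →
      ∑ k ∈ Finset.range N, h k * blaschke l₁ z ^ k +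
        e z * ∑ k ∈ Finset.range N, g k * blaschke l₁ z ^ k =
      blaschke l₁ z ^ N * ((z - star l₁) * A z)) :
    2 * Real.pi * I * ∑ k ∈ Finset.range N, h k = -∑ k ∈ Finset.range N, g k *
      ∫ s in (0 : ℝ)..1, e (f s) * ((blaschke l₁ (f s) ^ (N - k))⁻¹ / (f s - star l₁)) *
        deriv f s := by
  have hu : Set.uIcc (0 : ℝ) 1 = Set.Icc 0 1 := Set.uIcc_of_le zero_le_one
  have hi1 : ∀ m, IntervalIntegrable (fun s => (blaschke l₁ (f s) ^ m)⁻¹ / (f s - star l₁) *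
      deriv f s) MeasureTheory.volume 0 1 := fun m =>
    (((continuousOn_kernel hl₁ hf him m).mul
      (hf.continuous_deriv le_rfl).continuousOn).mono hu.le).intervalIntegrable
  have hi2 : ∀ m, IntervalIntegrable (fun s => e (f s) * ((blaschke l₁ (f s) ^ m)⁻¹ /
      (f s - star l₁)) * deriv f s) MeasureTheory.volume 0 1 := fun m =>
    ((((he.comp hf.continuous).continuousOn.mul (continuousOn_kernel hl₁ hf him m)).mul
      (hf.continuous_deriv le_rfl).continuousOn).mono hu.le).intervalIntegrable
  rw [eq_neg_iff_add_eq_zero, ← integral_entire_mul_deriv_eq_zero hf hf1 hA]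
  have e1 : 2 * Real.pi * I * ∑ k ∈ Finset.range N, h k = ∑ k ∈ Finset.range N,
      ∫ s in (0 : ℝ)..1, h k * ((blaschke l₁ (f s) ^ (N - k))⁻¹ / (f s - star l₁) *
        deriv f s) := by
    rw [Finset.mul_sum]
    refine Finset.sum_congr rfl fun k hk => ?_
    obtain ⟨m, hm⟩ : ∃ m, N - k = m + 1 := ⟨N - k - 1, by have := Finset.mem_range.1 hk; omega⟩
    rw [intervalIntegral.integral_const_mul, hm, integral_kernel hl₁ hf hf1 him hw, mul_comm]
  have e2 : ∀ k, g k * (∫ s in (0 : ℝ)..1, e (f s) * ((blaschke l₁ (f s) ^ (N - k))⁻¹ /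
      (f s - star l₁)) * deriv f s) = ∫ s in (0 : ℝ)..1, g k * (e (f s) *
        ((blaschke l₁ (f s) ^ (N - k))⁻¹ / (f s - star l₁)) * deriv f s) := fun k => by
    rw [intervalIntegral.integral_const_mul]
  simp only [e1, e2]
  rw [← intervalIntegral.integral_finsetSum fun k _ => (hi1 _).const_mul _,
    ← intervalIntegral.integral_finsetSum fun k _ => (hi2 _).const_mul _,
    ← intervalIntegral.integral_add]
  · refine intervalIntegral.integral_congr fun s hs => ?_
    rw [hu] at hs
    have h2 := ne_star_of_im_pos hl₁ (him s hs).1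
    have h3 := blaschke_ne_zero (him s hs).2 h2
    have h2' := sub_ne_zero.2 h2
    have e3 : A (f s) = (blaschke l₁ (f s) ^ N)⁻¹ / (f s - star l₁) *
        (blaschke l₁ (f s) ^ N * ((f s - star l₁) * A (f s))) := by
      field_simp
    rw [e3, ← hhg _ (him s hs).2 h2, mul_add, mul_left_comm _ (e (f s)), Finset.mul_sum,
      Finset.mul_sum, add_mul, Finset.mul_sum, Finset.sum_mul, Finset.sum_mul]
    congr 1 <;>
    · refine Finset.sum_congr rfl fun k hk => ?_
      rw [show N = (N - k) + k by have := Finset.mem_range.1 hk; omega, pow_add]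
      simp only [Nat.add_sub_cancel]
      field_simp
  · simpa only [Finset.sum_fn] using IntervalIntegrable.sum (Finset.range N)
      fun k _ => (hi1 (N - k)).const_mul (h k)
  · simpa only [Finset.sum_fn] using IntervalIntegrable.sum (Finset.range N)
      fun k _ => (hi2 (N - k)).const_mul (g k)

/-- At `(x, t) = (N X, N T)` the exponential times `r ^ (-N)` is the `N`-th power of `expPhase`, and
the remaining factor `r ^ k` is bounded by `1` in the upper half plane. -/
lemma norm_integral_exp_mul_kernel_le (hl₁ : 0 < l₁.im)
    (him : ∀ s ∈ Set.Icc (0 : ℝ) 1, 0 < (f s).im ∧ f s ≠ l₁) {X T ρ C : ℝ}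
    (hρ : ∀ s ∈ Set.Icc (0 : ℝ) 1, ‖expPhase l₁ X T (f s)‖ ≤ ρ)
    (hC : ∀ s ∈ Set.Icc (0 : ℝ) 1, ‖deriv f s / (f s - star l₁)‖ ≤ C) (N k : ℕ) :
    ‖∫ s in (0 : ℝ)..1, exp (2 * I * (f s * (N * X : ℝ) + f s ^ 2 * (N * T : ℝ))) *
      ((blaschke l₁ (f s) ^ (N - k))⁻¹ / (f s - star l₁)) * deriv f s‖ ≤ ρ ^ N * C := by
  have key := intervalIntegral.norm_integral_le_of_norm_le_const (a := (0 : ℝ)) (b := 1)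
    (C := ρ ^ N * C) (f := fun s => exp (2 * I * (f s * (N * X : ℝ) + f s ^ 2 * (N * T : ℝ))) *
      ((blaschke l₁ (f s) ^ (N - k))⁻¹ / (f s - star l₁)) * deriv f s) ?_
  · simpa using key
  intro s hs
  rw [Set.uIoc_of_le zero_le_one] at hs
  have hs' : s ∈ Set.Icc (0 : ℝ) 1 := Set.Ioc_subset_Icc_self hs
  have h2 := ne_star_of_im_pos hl₁ (him s hs').1
  have h3 := blaschke_ne_zero (him s hs').2 h2
  have e1 : exp (2 * I * (f s * (N * X : ℝ) + f s ^ 2 * (N * T : ℝ))) *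
      ((blaschke l₁ (f s) ^ (N - k))⁻¹ / (f s - star l₁)) * deriv f s =
      exp (2 * I * (f s * X + f s ^ 2 * T)) ^ N * (blaschke l₁ (f s) ^ (N - k))⁻¹ *
        (deriv f s / (f s - star l₁)) := by
    rw [← Complex.exp_nat_mul]
    push_cast
    ring_nf
  have e2 : ‖exp (2 * I * (f s * X + f s ^ 2 * T)) ^ N * (blaschke l₁ (f s) ^ (N - k))⁻¹‖ ≤
      ‖expPhase l₁ X T (f s)‖ ^ N := by
    have : expPhase l₁ X T (f s) =
        exp (2 * I * (f s * X + f s ^ 2 * T)) * (blaschke l₁ (f s))⁻¹ := by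
      rw [expPhase, blaschke, inv_div]
    rw [this, norm_mul, norm_mul, mul_pow, norm_pow, norm_inv, norm_inv, norm_pow, inv_pow]
    refine mul_le_mul_of_nonneg_left ?_ (by positivity)
    have hb : 0 < ‖blaschke l₁ (f s)‖ := norm_pos_iff.2 h3
    exact inv_anti₀ (by positivity) (pow_le_pow_of_le_one hb.le
      (norm_blaschke_le_one hl₁ (him s hs').1) (Nat.sub_le N k))
  rw [e1, norm_mul]
  refine mul_le_mul (e2.trans (pow_le_pow_left₀ (norm_nonneg _) (hρ s hs') N)) (hC s hs')
    (norm_nonneg _) (pow_nonneg ((norm_nonneg _).trans (hρ s hs')) N)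

end Contour

/-! ### The iterated dressing -/

open scoped ComplexOrder in
lemma star_dotProduct_self_ne_zero {v : Fin 3 → ℂ} (hv : v ≠ 0) : star v ⬝ᵥ v ≠ 0 :=
  dotProduct_star_self_eq_zero.not.2 hv

lemma proj_mulVec (v w : Fin 3 → ℂ) :
    proj v *ᵥ w = ((star v ⬝ᵥ v)⁻¹ * (star v ⬝ᵥ w)) • v := by
  ext i
  simp [proj, smul_mulVec, vecMulVec_mulVec]
  ring

lemma proj_mulVec_self (v : Fin 3 → ℂ) : proj v *ᵥ v = v := by
  rcases eq_or_ne v 0 with rfl | hv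
  · simp
  · rw [proj_mulVec, inv_mul_cancel₀ (star_dotProduct_self_ne_zero hv), one_smul]

lemma proj_mul_self (v : Fin 3 → ℂ) : proj v * proj v = proj v := by
  rcases eq_or_ne v 0 with rfl | hv
  · simp [proj]
  · rw [proj, smul_mul_smul_comm, vecMulVec_mul_vecMulVec, vecMulVec_smul, smul_smul, mul_assoc,
      inv_mul_cancel₀ (star_dotProduct_self_ne_zero hv), mul_one]

lemma conjTranspose_proj (v : Fin 3 → ℂ) : (proj v)ᴴ = proj v := by
  have h : star (star v ⬝ᵥ v) = star v ⬝ᵥ v := (star_dotProduct v v).symm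
  rw [proj, conjTranspose_smul, star_inv₀, h, conjTranspose_vecMulVec, star_star]

lemma elemDarboux_eq {l₁ z : ℂ} (v : Fin 3 → ℂ) (h2 : z ≠ star l₁) :
    elemDarboux l₁ v z = (1 - proj v) + blaschke l₁ z • proj v := by
  rw [elemDarboux, ← one_sub_blaschke h2]
  module

lemma elemDarboux_mul_inverse {l₁ z : ℂ} (v : Fin 3 → ℂ) (h1 : z ≠ l₁) (h2 : z ≠ star l₁) :
    elemDarboux l₁ v z * ((1 - proj v) + (blaschke l₁ z)⁻¹ • proj v) = 1 := by
  have hr := blaschke_ne_zero h1 h2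
  rw [elemDarboux_eq v h2]
  simp only [add_mul, mul_add, sub_mul, mul_sub, one_mul, mul_one, smul_mul_assoc, mul_smul_comm,
    proj_mul_self, smul_smul, sub_self, zero_add, inv_mul_cancel₀ hr, one_smul]
  abel

lemma elemDarboux_inv {l₁ z : ℂ} (v : Fin 3 → ℂ) (h1 : z ≠ l₁) (h2 : z ≠ star l₁) :
    (elemDarboux l₁ v z)⁻¹ = (1 - proj v) + (blaschke l₁ z)⁻¹ • proj v :=
  Matrix.inv_eq_right_inv (elemDarboux_mul_inverse v h1 h2)

lemma eventually_ne_ne {l₁ : ℂ} (hl₁ : 0 < l₁.im) :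
    ∀ᶠ z in 𝓝[≠] l₁, z ≠ l₁ ∧ z ≠ star l₁ := by
  refine Filter.Eventually.and self_mem_nhdsWithin (nhdsWithin_le_nhds ?_)
  exact isOpen_ne.mem_nhds (ne_star_of_im_pos hl₁ hl₁)

lemma limVec_eq {l₁ : ℂ} (hl₁ : 0 < l₁.im) {c : Fin 2 → ℂ} {Φ : ℂ → Matrix (Fin 3) (Fin 3) ℂ}
    {ψ : ℂ → Fin 3 → ℂ} (hψ : ContinuousAt ψ l₁)
    (h : ∀ z, z ≠ l₁ → z ≠ star l₁ → Φ z *ᵥ seed c = ψ z) : limVec l₁ c Φ = ψ l₁ := by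
  refine Filter.Tendsto.limUnder_eq ((hψ.tendsto.mono_left nhdsWithin_le_nhds).congr' ?_)
  filter_upwards [eventually_ne_ne hl₁] with z hz
  exact (h z hz.1 hz.2).symm

/-- At the origin `(x, t) = (0, 0)` the two Darboux matrices in each dressing step cancel. -/
lemma dressed_origin {l₁ : ℂ} (c : Fin 2 → ℂ) (j : ℕ) {z : ℂ} (h1 : z ≠ l₁)
    (h2 : z ≠ star l₁) : dressed l₁ c j 0 0 z = 1 := by
  induction j with
  | zero =>
    simp only [dressed, expSigma]
    ext i k
    fin_cases i <;> fin_cases k <;> simp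
  | succ j ih =>
    simp only [dressed]
    rw [ih, mul_one, elemDarboux_inv _ h1 h2, elemDarboux_mul_inverse _ h1 h2]

lemma limVec_dressed_origin {l₁ : ℂ} (hl₁ : 0 < l₁.im) (c : Fin 2 → ℂ) (j : ℕ) :
    limVec l₁ c (dressed l₁ c j 0 0) = seed c :=
  limVec_eq (ψ := fun _ => seed c) hl₁ continuousAt_const fun z h1 h2 => by
    rw [dressed_origin c j h1 h2, one_mulVec]

lemma dressed_succ_mulVec_seed {l₁ : ℂ} (hl₁ : 0 < l₁.im) (c : Fin 2 → ℂ) (j : ℕ) (x t : ℝ) {z : ℂ}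
    (h1 : z ≠ l₁) (h2 : z ≠ star l₁) :
    dressed l₁ c (j + 1) x t z *ᵥ seed c = (blaschke l₁ z)⁻¹ •
      (elemDarboux l₁ (dressedVec l₁ c j x t) z *ᵥ (dressed l₁ c j x t z *ᵥ seed c)) := by
  have e : ((1 - proj (seed c)) + (blaschke l₁ z)⁻¹ • proj (seed c)) *ᵥ seed c =
      (blaschke l₁ z)⁻¹ • seed c := by
    rw [add_mulVec, sub_mulVec, one_mulVec, smul_mulVec, proj_mulVec_self, sub_self, zero_add]
  simp only [dressed]
  rw [limVec_dressed_origin hl₁, elemDarboux_inv _ h1 h2, ← mulVec_mulVec, e, mulVec_smul,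
    mulVec_mulVec, dressedVec]

lemma expSigma_mulVec_seed (a : ℂ) (c : Fin 2 → ℂ) :
    expSigma a *ᵥ seed c = ![exp a, exp (-a) * c 0, exp (-a) * c 1] := by
  ext i
  rw [expSigma, mulVec_diagonal]
  fin_cases i <;> simp [seed]

/-- The vector `Φ^{[j]}(z; x, t) (1, c₁, c₂)ᵀ` extends to an entire function of `z`: at each step the
zero at `l₁` of the component annihilated by `T^{[j+1]}(l₁)` cancels the pole of
`T^{[j+1]}(z; 0, 0)⁻¹ (1, c₁, c₂)ᵀ`. Its last two components are proportional to `(c₁, c₂)`. -/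
lemma exists_entire_dressed_mulVec_seed {l₁ : ℂ} (hl₁ : 0 < l₁.im) (c : Fin 2 → ℂ) (x t : ℝ)
    (j : ℕ) :
    ∃ ψ : ℂ → Fin 3 → ℂ, Differentiable ℂ ψ ∧ (∀ z, ψ z 1 * c 1 = ψ z 2 * c 0) ∧
      dressedVec l₁ c j x t = ψ l₁ ∧
      ∀ z, z ≠ l₁ → z ≠ star l₁ → dressed l₁ c j x t z *ᵥ seed c = ψ z ∧
        darboux l₁ c j x t z *ᵥ (expSigma (-(I * z * (x + z * t))) *ᵥ seed c) =
          blaschke l₁ z ^ j • ψ z := by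
  induction j with
  | zero =>
    have hd : Differentiable ℂ fun z : ℂ => expSigma (-(I * z * (x + z * t))) *ᵥ seed c := by
      simp only [expSigma_mulVec_seed]
      rw [differentiable_pi]
      intro i
      fin_cases i
      · change Differentiable ℂ fun z : ℂ => exp (-(I * z * (x + z * t)))
        fun_prop
      · change Differentiable ℂ fun z : ℂ => exp (-(-(I * z * (x + z * t)))) * c 0
        fun_prop
      · change Differentiable ℂ fun z : ℂ => exp (-(-(I * z * (x + z * t)))) * c 1
        fun_prop
    refine ⟨_, hd, fun z => ?_, ?_, fun z _ _ => ⟨rfl, ?_⟩⟩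
    · simp only [expSigma_mulVec_seed, cons_val]
      ring
    · exact limVec_eq hl₁ hd.continuous.continuousAt fun z _ _ => rfl
    · simp [darboux]
  | succ j ih =>
    obtain ⟨ψ, hd, hc, hv, h⟩ := ih
    set v := dressedVec l₁ c j x t with hvdef
    set F : ℂ → Fin 3 → ℂ := fun z => (1 - proj v) *ᵥ ψ z with hF
    have hlin : ∀ M : Matrix (Fin 3) (Fin 3) ℂ, Differentiable ℂ fun z => M *ᵥ ψ z := fun M => by
      have := (LinearMap.toContinuousLinearMap (Matrix.mulVecLin M)).differentiable.comp hd
      exact this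
    have hF0 : F l₁ = 0 := by
      simp only [hF, ← hv]
      rw [sub_mulVec, one_mulVec, proj_mulVec_self, sub_self]
    have hds : Differentiable ℂ (dslope F l₁) := by
      have := (Complex.differentiableOn_dslope (f := F) (c := l₁) Filter.univ_mem).2
        (hlin _).differentiableOn
      exact differentiableOn_univ.1 this
    set ψ' : ℂ → Fin 3 → ℂ := fun z => (z - star l₁) • dslope F l₁ z + proj v *ᵥ ψ z with hψ'
    have hd' : Differentiable ℂ ψ' :=
      ((differentiable_id.sub_const _).smul hds).add (hlin _)
    have hval : ∀ z, z ≠ l₁ → z ≠ star l₁ →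
        ψ' z = (blaschke l₁ z)⁻¹ • (elemDarboux l₁ v z *ᵥ ψ z) := by
      intro z h1 h2
      have hr := blaschke_ne_zero h1 h2
      rw [elemDarboux_eq _ h2, add_mulVec, smul_mulVec, smul_add, smul_smul, inv_mul_cancel₀ hr,
        one_smul]
      simp only [hψ']
      rw [dslope_of_ne _ h1, slope_def_module, hF0, sub_zero, smul_smul, blaschke, inv_div,
        div_eq_mul_inv]
    have heq : ∀ z, z ≠ l₁ → z ≠ star l₁ → dressed l₁ c (j + 1) x t z *ᵥ seed c = ψ' z := by
      intro z h1 h2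
      rw [dressed_succ_mulVec_seed hl₁ c j x t h1 h2, (h z h1 h2).1, hval z h1 h2]
    refine ⟨ψ', hd', ?_, limVec_eq hl₁ hd'.continuous.continuousAt heq,
      fun z h1 h2 => ⟨heq z h1 h2, ?_⟩⟩
    · have hvc : v 1 * c 1 = v 2 * c 0 := by rw [hv]; exact hc l₁
      have hP : ∀ z, (proj v *ᵥ ψ z) 1 * c 1 = (proj v *ᵥ ψ z) 2 * c 0 := by
        intro z
        rw [proj_mulVec]
        simp only [Pi.smul_apply, smul_eq_mul]
        linear_combination ((star v ⬝ᵥ v)⁻¹ * (star v ⬝ᵥ ψ z)) * hvc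
      have hcont : ∀ i, Continuous fun z => ψ' z i := fun i =>
        (continuous_apply i).comp hd'.continuous
      -- the relation holds off `l₁`, and extends by continuity
      refine congr_fun (Continuous.ext_on (dense_compl_singleton l₁)
        ((hcont 1).mul continuous_const) ((hcont 2).mul continuous_const) fun z hz => ?_)
      have hz : z ≠ l₁ := hz
      simp only [hψ', Pi.add_apply, Pi.smul_apply, smul_eq_mul]
      rw [dslope_of_ne _ hz, slope_def_module, hF0, sub_zero]
      simp only [hF, sub_mulVec, one_mulVec, Pi.smul_apply, Pi.sub_apply, smul_eq_mul]
      linear_combination ((z - star l₁) * (z - l₁)⁻¹) * (hc z - hP z) + hP z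
    · have hr := blaschke_ne_zero h1 h2
      rw [hval z h1 h2, darboux, ← mulVec_mulVec, (h z h1 h2).2, mulVec_smul, smul_smul, pow_succ,
        mul_assoc, mul_inv_cancel₀ hr, mul_one]

/-- The Darboux matrix as a product of Blaschke–Potapov factors. -/
lemma darboux_eq {l₁ z : ℂ} (c : Fin 2 → ℂ) (x t : ℝ) (h2 : z ≠ star l₁) (N : ℕ) :
    darboux l₁ c N x t z = blaschke l₁ z ^ N • (1 : Matrix (Fin 3) (Fin 3) ℂ) +
      (1 - blaschke l₁ z) • (Polynomial.evalRingHom (blaschke l₁ z)).mapMatrix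
        (bpCofactor (fun j => proj (dressedVec l₁ c j x t)) N) := by
  induction N with
  | zero => simp [darboux, bpCofactor]
  | succ N ih =>
    simp only [darboux]
    rw [ih, elemDarboux_eq _ h2, eval_bpCofactor_succ]
    simp only [add_mul, mul_add, sub_mul, one_mul, mul_one, smul_mul_assoc, mul_smul_comm, smul_add,
      smul_sub, pow_succ]
    module

lemma soliton_eq (l₁ : ℂ) (c : Fin 2 → ℂ) (N : ℕ) (x t : ℝ) (i : Fin 2) :
    soliton l₁ c N x t i = 2 * (l₁ - star l₁) * (Polynomial.evalRingHom 1).mapMatrix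
      (bpCofactor (fun j => proj (dressedVec l₁ c j x t)) N) 0 i.succ := by
  rw [eval_one_bpCofactor, soliton, Matrix.sum_apply]
  have : ∀ j, (1 - proj (dressedVec l₁ c j x t)) 0 i.succ =
      -proj (dressedVec l₁ c j x t) 0 i.succ := fun j => by
    rw [Matrix.sub_apply, one_apply_ne (Fin.succ_ne_zero i).symm, zero_sub]
  simp only [this, Finset.sum_neg_distrib]
  ring

/-! ### The soliton as a coefficient of the Riemann–Hilbert matrix -/

lemma cvec_unit (α β γ : ℝ) : star (cvec α β γ 0) * cvec α β γ 0 +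
    star (cvec α β γ 1) * cvec α β γ 1 = 1 := by
  have h : ∀ (a b : ℝ), star ((a : ℂ) * exp (I * b)) * ((a : ℂ) * exp (I * b)) =
      ((a ^ 2 : ℝ) : ℂ) := by
    intro a b
    rw [Complex.star_def, Complex.conj_mul', norm_mul, mul_comm I, Complex.norm_exp_ofReal_mul_I,
      norm_real, mul_one]
    rw [← ofReal_pow, Real.norm_eq_abs, sq_abs]
  simp only [cvec, cons_val_zero, cons_val_one, h]
  rw [← ofReal_add, Real.cos_sq_add_sin_sq, ofReal_one]

/-- The vectors `Φ₁^{[j]}` have last two components proportional to `(c₁, c₂)`, so the off-diagonal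
part of the first row of `T_N` is proportional to `(c₁*, c₂*)`. -/
lemma eval_one_bpCofactor_row {l₁ : ℂ} (hl₁ : 0 < l₁.im) (α β γ : ℝ) (N : ℕ) (x t : ℝ) (i : Fin 2) :
    let K := (Polynomial.evalRingHom 1).mapMatrix
      (bpCofactor (fun j => proj (dressedVec l₁ (cvec α β γ) j x t)) N)
    star (cvec α β γ i) * (K 0 1 * cvec α β γ 0 + K 0 2 * cvec α β γ 1) = K 0 i.succ := by
  intro K
  set c := cvec α β γ with hc
  have hu := cvec_unit α β γ
  rw [← hc] at hu
  have hP : ∀ j, (1 - proj (dressedVec l₁ c j x t)) 0 1 * star (c 1) =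
      (1 - proj (dressedVec l₁ c j x t)) 0 2 * star (c 0) := by
    intro j
    obtain ⟨ψ, -, hψ, hv, -⟩ := exists_entire_dressed_mulVec_seed hl₁ c x t j
    have h := congr_arg star (hψ l₁)
    rw [← hv, star_mul', star_mul'] at h
    simp only [proj, Matrix.sub_apply, Matrix.smul_apply, vecMulVec_apply, Pi.star_apply,
      smul_eq_mul, one_apply_ne (show (0 : Fin 3) ≠ 1 by decide),
      one_apply_ne (show (0 : Fin 3) ≠ 2 by decide)]
    linear_combination -((star (dressedVec l₁ c j x t) ⬝ᵥ dressedVec l₁ c j x t)⁻¹ *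
      dressedVec l₁ c j x t 0) * h
  have hK : K 0 1 * star (c 1) = K 0 2 * star (c 0) := by
    simp only [K, eval_one_bpCofactor, Matrix.sum_apply, Finset.sum_mul]
    exact Finset.sum_congr rfl fun j _ => hP j
  fin_cases i
  · change star (c 0) * (K 0 1 * c 0 + K 0 2 * c 1) = K 0 1
    linear_combination K 0 1 * hu - c 1 * hK
  · change star (c 1) * (K 0 1 * c 0 + K 0 2 * c 1) = K 0 2
    linear_combination K 0 2 * hu + c 0 * hK

/-- Outside the disk the fractional powers of the Blaschke factor cancel in the entry `(0, 1)`. -/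
lemma matN_apply_zero_one {l₁ : ℂ} {α β γ R : ℝ} {N : ℕ} {X T : ℝ} {z : ℂ} (h1 : z ≠ l₁)
    (h2 : z ≠ star l₁) (hR : R ≤ ‖z‖) :
    matN l₁ α β γ R N X T z 0 1 = darboux l₁ (cvec α β γ) N (N * X) (N * T) z 0 1 * cvec α β γ 0 +
      darboux l₁ (cvec α β γ) N (N * X) (N * T) z 0 2 * cvec α β γ 1 := by
  have hr := blaschke_ne_zero h1 h2
  have hs : ∀ a : ℂ, blaschke l₁ z ^ a ≠ 0 := fun a => by
    rw [Complex.cpow_def_of_ne_zero hr]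
    exact exp_ne_zero _
  have hJ : (matJ l₁ N z)⁻¹ = Matrix.diagonal ![(blaschke l₁ z ^ (2 * (N : ℂ) / 3))⁻¹,
      (blaschke l₁ z ^ (-(N : ℂ) / 3))⁻¹, (blaschke l₁ z ^ (-(N : ℂ) / 3))⁻¹] := by
    refine Matrix.inv_eq_right_inv ?_
    rw [matJ, diagonal_mul_diagonal, ← diagonal_one]
    congr 1
    ext i
    fin_cases i <;> simp [hs]
  rw [matN, if_neg hR.not_gt, matM, if_neg hR.not_gt, hJ, mul_diagonal]
  simp only [mul_apply, Fin.sum_univ_three, conjTranspose_apply, matQH, Matrix.smul_apply,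
    smul_eq_mul, cvec]
  simp
  field_simp [hs]

lemma tendsto_sub_inv_cobounded (a : ℂ) :
    Tendsto (fun z : ℂ => (z - a)⁻¹) (cobounded ℂ) (𝓝 0) :=
  tendsto_inv₀_cobounded.comp (tendsto_sub_const_cobounded a)

lemma tendsto_mul_matN {l₁ : ℂ} (hl₁ : 0 < l₁.im) (α β γ R : ℝ) (N : ℕ) (X T : ℝ) (i : Fin 2) :
    Tendsto (fun z : ℂ => 2 * star (cvec α β γ i) * (z * matN l₁ α β γ R N X T z 0 1))
      (cobounded ℂ) (𝓝 (soliton l₁ (cvec α β γ) N (N * X) (N * T) i)) := by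
  set c := cvec α β γ with hc
  set H := bpCofactor (fun j => proj (dressedVec l₁ c j (N * X) (N * T))) N with hH
  have hinv := tendsto_sub_inv_cobounded (star l₁)
  have hne : ∀ a : ℂ, ∀ᶠ z in cobounded ℂ, z ≠ a := fun a => by
    filter_upwards [eventually_cobounded_le_norm (‖a‖ + 1)] with z hz h
    rw [h] at hz
    linarith
  have hone : Tendsto (fun z => (l₁ - star l₁) * (1 + star l₁ * (z - star l₁)⁻¹)) (cobounded ℂ)
      (𝓝 (l₁ - star l₁)) := by
    simpa using ((hinv.const_mul (star l₁)).const_add 1).const_mul (l₁ - star l₁)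
  have hr : Tendsto (fun z => blaschke l₁ z) (cobounded ℂ) (𝓝 1) := by
    have : Tendsto (fun z => 1 - (l₁ - star l₁) * (z - star l₁)⁻¹) (cobounded ℂ) (𝓝 1) := by
      simpa using (hinv.const_mul (l₁ - star l₁)).const_sub 1
    refine this.congr' ?_
    filter_upwards [hne (star l₁)] with z hz
    rw [← div_eq_mul_inv, ← one_sub_blaschke hz, sub_sub_cancel]
  have hev : ∀ k, Tendsto (fun z => (H 0 k).eval (blaschke l₁ z)) (cobounded ℂ)
      (𝓝 ((H 0 k).eval 1)) := fun k => ((H 0 k).continuous.tendsto 1).comp hr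
  have hlim := ((hone.mul (((hev 1).mul_const (c 0)).add ((hev 2).mul_const (c 1)))).const_mul
    (2 * star (c i)))
  have hval : 2 * star (c i) * ((l₁ - star l₁) * ((H 0 1).eval 1 * c 0 + (H 0 2).eval 1 * c 1)) =
      soliton l₁ c N (N * X) (N * T) i := by
    rw [soliton_eq, ← eval_one_bpCofactor_row hl₁]
    simp only [RingHom.mapMatrix_apply, map_apply, Polynomial.coe_evalRingHom]
    ring
  rw [← hval]
  refine hlim.congr' ?_
  filter_upwards [hne l₁, hne (star l₁), eventually_cobounded_le_norm R] with z h1 h2 hz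
  have h2' := sub_ne_zero.2 h2
  rw [matN_apply_zero_one h1 h2 hz, darboux_eq _ _ _ h2, ← hc, ← hH, one_sub_blaschke h2]
  simp only [Matrix.add_apply, Matrix.smul_apply, smul_eq_mul,
    one_apply_ne (show (0 : Fin 3) ≠ 1 by decide), one_apply_ne (show (0 : Fin 3) ≠ 2 by decide),
    RingHom.mapMatrix_apply, map_apply, Polynomial.coe_evalRingHom]
  field_simp
  ring

/-! ### The exponential estimate -/

lemma norm_add_mul_sq_le {c a : Fin 2 → ℂ} (hc : star (c 0) * c 0 + star (c 1) * c 1 = 1) :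
    ‖a 0 * c 0 + a 1 * c 1‖ ^ 2 ≤ ‖a 0‖ ^ 2 + ‖a 1‖ ^ 2 := by
  have hc' : ‖c 0‖ ^ 2 + ‖c 1‖ ^ 2 = 1 := by
    rw [Complex.star_def, Complex.conj_mul', Complex.conj_mul'] at hc
    exact_mod_cast hc
  have h := norm_add_le (a 0 * c 0) (a 1 * c 1)
  rw [norm_mul, norm_mul] at h
  nlinarith [sq_nonneg (‖a 0‖ * ‖c 1‖ - ‖a 1‖ * ‖c 0‖), norm_nonneg (a 0 * c 0 + a 1 * c 1),
    pow_le_pow_left₀ (norm_nonneg _) h 2]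

/-- The `O(r ^ N)` condition at `l₁` for the first row of `T_N`. -/
lemma exists_entire_row {l₁ : ℂ} (hl₁ : 0 < l₁.im) (c : Fin 2 → ℂ) (N : ℕ) (x t : ℝ) :
    ∃ A : ℂ → ℂ, Differentiable ℂ A ∧ ∀ z, z ≠ l₁ → z ≠ star l₁ →
      let H := bpCofactor (fun j => proj (dressedVec l₁ c j x t)) N
      ∑ k ∈ Finset.range N, coeffMat k H 0 0 * blaschke l₁ z ^ k +
        exp (2 * I * (z * x + z ^ 2 * t)) * ∑ k ∈ Finset.range N,
          (coeffMat k H 0 1 * c 0 + coeffMat k H 0 2 * c 1) * blaschke l₁ z ^ k =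
      blaschke l₁ z ^ N * ((z - star l₁) * A z) := by
  obtain ⟨ψ, hd, -, -, h⟩ := exists_entire_dressed_mulVec_seed hl₁ c x t N
  have hd0 : Differentiable ℂ fun z => ψ z 0 := differentiable_pi.1 hd 0
  refine ⟨fun z => (exp (I * z * (x + z * t)) * ψ z 0 - 1) / (l₁ - star l₁), by fun_prop,
    fun z h1 h2 => ?_⟩
  intro H
  have hl := sub_star_ne_zero hl₁
  have hz := sub_ne_zero.2 h2
  have key := congr_fun (h z h1 h2).2 0
  rw [darboux_eq c x t h2, expSigma_mulVec_seed, one_sub_blaschke h2] at key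
  simp only [mulVec, dotProduct, Fin.sum_univ_three, Matrix.add_apply, Matrix.smul_apply,
    smul_eq_mul, Pi.smul_apply, one_apply_eq, one_apply_ne (show (0 : Fin 3) ≠ 1 by decide),
    one_apply_ne (show (0 : Fin 3) ≠ 2 by decide), cons_val, eval_bpCofactor_eq_sum, neg_neg]
    at key
  have e1 : ∑ k ∈ Finset.range N, (coeffMat k H 0 1 * c 0 + coeffMat k H 0 2 * c 1) *
      blaschke l₁ z ^ k = (∑ k ∈ Finset.range N, coeffMat k H 0 1 * blaschke l₁ z ^ k) * c 0 +
        (∑ k ∈ Finset.range N, coeffMat k H 0 2 * blaschke l₁ z ^ k) * c 1 := by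
    rw [Finset.sum_mul, Finset.sum_mul, ← Finset.sum_add_distrib]
    exact Finset.sum_congr rfl fun k _ => by ring
  have e2 : exp (2 * I * (z * x + z ^ 2 * t)) =
      exp (I * z * (x + z * t)) * exp (I * z * (x + z * t)) := by
    rw [← Complex.exp_add]
    ring_nf
  have e3 : exp (-(I * z * (x + z * t))) = (exp (I * z * (x + z * t)))⁻¹ := Complex.exp_neg _
  rw [e3] at key
  rw [e1, e2]
  beta_reduce
  have hE : exp (I * z * (x + z * t)) ≠ 0 := exp_ne_zero _
  set E := exp (I * z * (x + z * t))
  set a0 := ∑ k ∈ Finset.range N, coeffMat k H 0 0 * blaschke l₁ z ^ k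
  set a1 := ∑ k ∈ Finset.range N, coeffMat k H 0 1 * blaschke l₁ z ^ k
  set a2 := ∑ k ∈ Finset.range N, coeffMat k H 0 2 * blaschke l₁ z ^ k
  field_simp at key ⊢
  linear_combination key

/-- The energy identity bounds the squared norm of the first row of the cofactor by its `(0, 0)`
entry at `r = 1`, the contour integral bounds that entry by the norm of the row times `ρ ^ N`. -/
lemma norm_soliton_le {l₁ : ℂ} (hl₁ : 0 < l₁.im) {f : ℝ → ℂ} (hf : ContDiff ℝ 1 f)
    (hf1 : f 1 = f 0) (him : ∀ s ∈ Set.Icc (0 : ℝ) 1, 0 < (f s).im ∧ f s ≠ l₁)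
    (hw : ∫ s in (0 : ℝ)..1, deriv f s / (f s - l₁) = 2 * Real.pi * I) {X T ρ C : ℝ}
    (hρ : ∀ s ∈ Set.Icc (0 : ℝ) 1, ‖expPhase l₁ X T (f s)‖ ≤ ρ)
    (hC : ∀ s ∈ Set.Icc (0 : ℝ) 1, ‖deriv f s / (f s - star l₁)‖ ≤ C) (α β γ : ℝ) (N : ℕ)
    (i : Fin 2) :
    ‖soliton l₁ (cvec α β γ) N (N * X) (N * T) i‖ ≤ 2 * ‖l₁ - star l₁‖ * (N * (ρ ^ N * C)) := by
  set c := cvec α β γ with hc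
  obtain ⟨A, hA, hrow⟩ := exists_entire_row hl₁ c N (N * X) (N * T)
  set H := bpCofactor (fun j => proj (dressedVec l₁ c j (N * X) (N * T))) N with hH
  set η := ρ ^ N * C with hη
  have hρ0 : 0 ≤ ρ := (norm_nonneg _).trans (hρ 0 ⟨le_rfl, zero_le_one⟩)
  have hC0 : 0 ≤ C := (norm_nonneg _).trans (hC 0 ⟨le_rfl, zero_le_one⟩)
  have hη0 : 0 ≤ η := by positivity
  set a : ℕ → Fin 2 → ℂ := fun k m => coeffMat k H 0 m.succ with ha
  set y := ∑ k ∈ Finset.range N, ‖a k 0 * c 0 + a k 1 * c 1‖ with hy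
  set S := ∑ k ∈ Finset.range N, (‖a k 0‖ ^ 2 + ‖a k 1‖ ^ 2) with hS
  have hy0 : 0 ≤ y := Finset.sum_nonneg fun _ _ => norm_nonneg _
  -- the contour integral
  have hcont := sum_coeff_eq_neg_sum_integral hl₁ hf hf1 him hw
    (h := fun k => coeffMat k H 0 0) (g := fun k => a k 0 * c 0 + a k 1 * c 1)
    (e := fun z => exp (2 * I * (z * (N * X : ℝ) + z ^ 2 * (N * T : ℝ)))) (by fun_prop) hA hrow
  have hsum : ‖∑ k ∈ Finset.range N, coeffMat k H 0 0‖ ≤ η * y := by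
    have h1 : ‖2 * Real.pi * I * ∑ k ∈ Finset.range N, coeffMat k H 0 0‖ ≤ η * y := by
      rw [hcont, norm_neg, hy, Finset.mul_sum]
      refine (norm_sum_le _ _).trans (Finset.sum_le_sum fun k _ => ?_)
      rw [norm_mul, mul_comm]
      exact mul_le_mul_of_nonneg_right
        (norm_integral_exp_mul_kernel_le hl₁ him hρ hC N k) (norm_nonneg _)
    have h2 : ‖(2 * Real.pi * I : ℂ)‖ = 2 * Real.pi := by
      simp [abs_of_pos Real.pi_pos]
    rw [norm_mul, h2] at h1
    nlinarith [Real.pi_gt_three, norm_nonneg (∑ k ∈ Finset.range N, coeffMat k H 0 0)]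
  -- the energy identity
  have hSle : S ≤ η * y := by
    have h1 := sum_norm_sq_coeffMat_bpCofactor
      (fun j => proj (dressedVec l₁ c j (N * X) (N * T))) (fun _ => proj_mul_self _)
      (fun _ => conjTranspose_proj _) N 0
    rw [← hH] at h1
    have h2 := congr_arg norm h1
    rw [norm_real, Real.norm_eq_abs] at h2
    refine le_trans (le_trans ?_ (le_abs_self _)) (h2.le.trans hsum)
    refine Finset.sum_le_sum fun k _ => ?_
    rw [Fin.sum_univ_three]
    have := sq_nonneg ‖coeffMat k H 0 0‖
    simp only [ha, Fin.succ_zero_eq_one, Fin.succ_one_eq_two]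
    linarith
  have hcs : ∀ u : ℕ → ℝ, (∀ k, u k ^ 2 ≤ ‖a k 0‖ ^ 2 + ‖a k 1‖ ^ 2) →
      (∑ k ∈ Finset.range N, u k) ^ 2 ≤ N * S := by
    intro u hu
    have := sq_sum_le_card_mul_sum_sq (s := Finset.range N) (f := u)
    rw [Finset.card_range] at this
    exact this.trans (mul_le_mul_of_nonneg_left (Finset.sum_le_sum fun k _ => hu k)
      (Nat.cast_nonneg N))
  have hN0 : (0 : ℝ) ≤ N := Nat.cast_nonneg N
  have hyle : y ≤ N * η := by
    have h1 : y ^ 2 ≤ N * S := hcs _ fun k => norm_add_mul_sq_le (cvec_unit α β γ)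
    rcases hy0.eq_or_lt with h0 | h0
    · rw [← h0]
      positivity
    · have h2 : y * y ≤ (N * η) * y := by
        calc y * y = y ^ 2 := (sq y).symm
          _ ≤ N * (η * y) := h1.trans (mul_le_mul_of_nonneg_left hSle hN0)
          _ = _ := by ring
      exact le_of_mul_le_mul_right h2 h0
  have hval : ‖∑ k ∈ Finset.range N, a k i‖ ≤ N * η := by
    have h1 : (∑ k ∈ Finset.range N, ‖a k i‖) ^ 2 ≤ N * S := hcs _ fun k => by
      fin_cases i
      · exact le_add_of_nonneg_right (sq_nonneg _)
      · exact le_add_of_nonneg_left (sq_nonneg _)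
    refine (norm_sum_le _ _).trans ?_
    refine le_of_sq_le_sq ?_ (by positivity)
    calc _ ≤ N * S := h1
      _ ≤ N * (η * (N * η)) := mul_le_mul_of_nonneg_left
        (hSle.trans (mul_le_mul_of_nonneg_left hyle hη0)) hN0
      _ = _ := by ring
  rw [soliton_eq, ← hH, eval_bpCofactor_eq_sum, norm_mul, norm_mul, RCLike.norm_ofNat]
  simp only [one_pow, mul_one]
  exact mul_le_mul_of_nonneg_left hval (by positivity)

lemma exists_exp_bound {ρ : ℝ} (h0 : 0 ≤ ρ) (h1 : ρ < 1) :
    ∃ d B : ℝ, 0 < d ∧ ∀ N : ℕ, N * ρ ^ N ≤ B * Real.exp (-d * N) := by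
  have hσ : 0 < max ρ (1 / 2) := lt_of_lt_of_le (by norm_num) (le_max_right _ _)
  have hlog : Real.log (max ρ (1 / 2)) < 0 := Real.log_neg hσ (max_lt h1 (by norm_num))
  set d := -Real.log (max ρ (1 / 2)) / 2 with hd
  have hd0 : 0 < d := by linarith
  refine ⟨d, d⁻¹, hd0, fun N => ?_⟩
  have e1 : ρ ^ N ≤ Real.exp (-d * N) * Real.exp (-d * N) := by
    rw [← Real.exp_add, show -d * N + -d * N = N * Real.log (max ρ (1 / 2)) by rw [hd]; ring,
      Real.exp_nat_mul, Real.exp_log hσ]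
    exact pow_le_pow_left₀ h0 (le_max_left _ _) N
  have e2 : N * Real.exp (-d * N) ≤ d⁻¹ := by
    have h3 : d * N ≤ Real.exp (d * N) := by linarith [Real.add_one_le_exp (d * N)]
    rw [neg_mul, Real.exp_neg, ← div_eq_mul_inv, div_le_iff₀ (Real.exp_pos _),
      inv_mul_eq_div, le_div_iff₀ hd0]
    linarith
  calc N * ρ ^ N ≤ N * (Real.exp (-d * N) * Real.exp (-d * N)) :=
        mul_le_mul_of_nonneg_left e1 (Nat.cast_nonneg N)
    _ = (N * Real.exp (-d * N)) * Real.exp (-d * N) := by ring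
    _ ≤ _ := mul_le_mul_of_nonneg_right e2 (Real.exp_pos _).le

end CNLS

end

theorem theorem1p4 (l₁ : ℂ) (hl₁ : 0 < l₁.im) (X T : ℝ) (hXT : CNLS.InExpDecayRegion l₁ X T) :
    ∃ d : ℝ, 0 < d ∧ ∀ (α β γ : ℝ) (i : Fin 2),
      (∀ (N : ℕ) (R : ℝ), ‖l₁‖ < R →
        Tendsto (fun z : ℂ => 2 * star (CNLS.cvec α β γ i) *
            (z * CNLS.matN l₁ α β γ R N X T z 0 1))
          (cobounded ℂ)
          (𝓝 (CNLS.soliton l₁ (CNLS.cvec α β γ) N (N * X) (N * T) i))) ∧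
      (fun N : ℕ => CNLS.soliton l₁ (CNLS.cvec α β γ) N (N * X) (N * T) i)
        =O[atTop] (fun N : ℕ => Real.exp (-d * N)) := by
  obtain ⟨g, hg⟩ := hXT.upper
  obtain ⟨f, ρ, hf, hf1, him, hw, hρ1, hρ⟩ := CNLS.exists_contour_norm_expPhase_le hl₁ hg
  have hρ0 : 0 ≤ ρ := (norm_nonneg _).trans (hρ 0 ⟨le_rfl, zero_le_one⟩)
  obtain ⟨C, hC⟩ := isCompact_Icc.exists_bound_of_continuousOn (s := Set.Icc (0 : ℝ) 1)
    (f := fun s => deriv f s / (f s - star l₁))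
    ((hf.continuous_deriv le_rfl).continuousOn.div (hf.continuous.sub continuous_const).continuousOn
      fun s hs => sub_ne_zero.2 (CNLS.ne_star_of_im_pos hl₁ (him s hs).1))
  have hC0 : 0 ≤ C := (norm_nonneg _).trans (hC 0 ⟨le_rfl, zero_le_one⟩)
  obtain ⟨d, B, hd, hB⟩ := CNLS.exists_exp_bound hρ0 hρ1
  refine ⟨d, hd, fun α β γ i => ⟨fun N R _ => CNLS.tendsto_mul_matN hl₁ α β γ R N X T i, ?_⟩⟩
  refine IsBigO.of_bound (2 * ‖l₁ - star l₁‖ * C * B) (Eventually.of_forall fun N => ?_)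
  rw [Real.norm_eq_abs, Real.abs_exp]
  calc _ ≤ 2 * ‖l₁ - star l₁‖ * (N * (ρ ^ N * C)) :=
        CNLS.norm_soliton_le hl₁ hf hf1 him hw hρ hC α β γ N i
    _ = 2 * ‖l₁ - star l₁‖ * C * (N * ρ ^ N) := by ring
    _ ≤ 2 * ‖l₁ - star l₁‖ * C * (B * Real.exp (-d * N)) :=
        mul_le_mul_of_nonneg_left (hB N) (by positivity)
    _ = _ := by ring
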